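/- **Setting.** An asset has value $\theta$ with prior distribution $F$, whose support $\Theta$ has lowest point $\underline\theta$ and highest point $\overline\theta$, $0\le\underline\theta<\overline\theta<\infty$; let $\mu=E_F[\theta]$. A *test* $T$ is a Markov kernel from values to scores that is unbiased, $E[\theta\mid s]=s$; $G_T$ is the marginal law of the score. A *test-fee structure* consists of a test (or its score distribution) and a pair of fees $\phi=(\phi_t,\phi_d)\in\mathbb R^2$ (testing fee, disclosure fee). It induces the following game. The agent, not knowing $\theta$, has the asset tested with probability $\sigma_t$, paying $\phi_t$ if he does so and then observing the score $s$; he discloses the score with probability $\sigma_d(s)$, paying $\phi_d$ if he does so. Two buyers with common value $\theta$ observe the disclosed score or, if the asset is untested or the score is concealed, a null message, and bid in a first-price auction with ties broken uniformly. The agent gets the price minus the fees he pays. $\Sigma(T,\phi)$ is the set of perfect Bayesian equilibria $(\sigma,\rho)$, where $\rho$ are the buyers' beliefs: they are common to the buyers and supported in $\Theta$, are the posterior given the score after a disclosed score, obey Bayes' rule after the null message whenever it has positive probability, and otherwise are, after the null message, a mixture of the prior and of posteriors given possible scores. The *maximal revenue guarantee* is $$R_M=\sup_{(T,\phi)}\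 \inf_{(\sigma,\rho)\in\Sigma(T,\phi)}\ \sigma_t\Big(\phi_t+\phi_d\int\sigma_d(s)\,dG_T(s)\Big).$$ Let $\Gamma(F)$ be the set of mean-preserving contractions of $F$: distributions $G$ supported in $[\underline\theta,\overline\theta]$ with $\int_{\underline\theta}^{x}G(s)\,ds\le\int_{\underline\theta}^{x}F(s)\,ds$ for all $x\in[\underline\theta,\overline\theta]$, with equality at $x=\overline\theta$ (distributions are identified with their CDFs). A test-fee structure $(G,\phi)$ is *robustly optimal* if for some $\tau$ the triple $(G,\phi,\tau)$ maximizes $\phi_t+\phi_d(1-G(\tau))$ over $G\in\Gamma(F)$, $\phi\in\mathbb R^2$ and $\tau\in\mathbb R$ with $\tau$ at least the lowest score in the support of $G$, subject to $$\phi_t\le\int_{\mu+\phi_d}^{\overline\theta}\big[s-(\mu+\phi_d)\big]\,dG(s),\qquad \tau-\phi_d=E_G[s\mid s\le\tau],\qquad \tau'-\phi_d\ge E_G[s\mid s\le\tau']\ \ \forall\,\tau'>\tau,$$ where $E_G[s\mid s\le\tau]=\tau$ if $\tau$ is the lowest score in the support of $G$. $(G,\phi)$ is in the *step-exponential-step class*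 if there are $g\in[0,1]$ and $\tau_0<\tau_1<\tau_2\le\tau_3$ such that $G=0$ on $(-\infty,\tau_0)$, $G=g$ on $[\tau_0,\tau_1)$, $G(s)=g\,e^{(s-\tau_1)/(\tau_1-\tau_0)}$ on $[\tau_1,\tau_2)$, $G=g\,e^{(\tau_2-\tau_1)/(\tau_1-\tau_0)}$ on $[\tau_2,\tau_3)$, $G=1$ on $[\tau_3,\infty)$, and $$\phi_d=\tau_1-\tau_0,\qquad \phi_t=\big(1-g\,e^{(\tau_2-\tau_1)/\phi_d}\big)\big(\tau_3-(\mu+\phi_d)\big).$$ **Proposition.** For every such $F$: (a) There exists a test-fee structure in the step-exponential-step class that is robustly optimal. (b) Every robustly optimal test-fee structure has a strictly positive disclosure fee, $\phi_d>0$. (c) If $(G,\phi)$ is robustly optimal, then $\phi_t>0$ if and only if scores in $(\mu+\phi_d,\overline\theta]$ have positive probability under $G$. (d) $R_M\le(\overline\theta-\mu)\big(1-e^{(\underline\theta-\mu)/(\overline\theta-\mu)}\big)$, with equality if the support of $F$ is $\{\underline\theta,\overline\theta\}$. -/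

import Mathlib

open MeasureTheory ProbabilityTheory

noncomputable section

/-- A pair of a testing fee and a disclosure fee. -/
structure Fees where
  testing : ℝ
  disclosure : ℝ

/-! ### The game between the agent and the two buyers -/

/-- A test of an asset with prior `F`: a stochastic map from asset values to scores such that every
score is an unbiased estimate of the value, `E[θ | s] = s`. -/
structure UnbiasedTest (F : Measure ℝ) [IsProbabilityMeasure F] where
  kernel : Kernel ℝ ℝ
  isMarkov : IsMarkovKernel kernel
  unbiased : ∀ᵐ s ∂(kernel ∘ₘ F), ∫ θ, θ ∂(posterior kernel F s) = s

attribute [instance] UnbiasedTest.isMarkov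

section Game

variable {F : Measure ℝ} [IsProbabilityMeasure F]

/-- The marginal score distribution of a test. -/
def UnbiasedTest.scoreLaw (T : UnbiasedTest F) : Measure ℝ := T.kernel ∘ₘ F

/-- The set of scores that a test can produce. -/
def UnbiasedTest.scores (T : UnbiasedTest F) : Set ℝ := T.scoreLaw.support

/-- What the buyers observe: `some s` is the disclosure of the score `s`, `none` the null message
(the asset is untested or its score is concealed). -/
abbrev Message := Option ℝ

/-- The null message and the disclosures of the scores that a test can produce. -/
def UnbiasedTest.messages (T : UnbiasedTest F) : Set Message :=
  insert none (some '' T.scores)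

/-- A strategy profile together with a belief system. `testProb` and `discloseProb` are the agent's
behavioral strategy, `bid i m` is buyer `i`'s bid after the message `m`, and `belief i m` his
posterior about the value of the asset. -/
structure Assessment where
  testProb : ℝ
  discloseProb : ℝ → ℝ
  bid : Fin 2 → Message → ℝ
  belief : Fin 2 → Message → Measure ℝ

/-- The price after a message: the asset is sold to the highest bidder. -/
def Assessment.price (a : Assessment) (m : Message) : ℝ := max (a.bid 0 m) (a.bid 1 m)

/-- Expected payoff of a buyer who holds the belief `ρ`, bids `b`, and faces the bid `b'`, in a
first-price auction with ties broken uniformly. -/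
def buyerPayoff (ρ : Measure ℝ) (b b' : ℝ) : ℝ :=
  if b' < b then ∫ θ, (θ - b) ∂ρ else if b = b' then (∫ θ, (θ - b) ∂ρ) / 2 else 0

/-- Continuation payoff (gross of the testing fee) of an agent with score `s` who discloses with
probability `d`. -/
def Assessment.disclosurePayoff (a : Assessment) (φ : Fees) (s d : ℝ) : ℝ :=
  d * (a.price (some s) - φ.disclosure) + (1 - d) * a.price none

/-- Expected payoff of an agent who has the asset tested with probability `t`. -/
def Assessment.agentPayoff (a : Assessment) (T : UnbiasedTest F) (φ : Fees) (t : ℝ) : ℝ :=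
  t * (-φ.testing + ∫ s, a.disclosurePayoff φ s (a.discloseProb s) ∂T.scoreLaw)
    + (1 - t) * a.price none

/-- The (unnormalized) joint probability that the value lies in a given set and that the buyers
observe the null message. -/
def Assessment.nullLaw (a : Assessment) (T : UnbiasedTest F) : Measure ℝ :=
  ENNReal.ofReal (1 - a.testProb) • F +
    ENNReal.ofReal a.testProb •
      ((F ⊗ₘ T.kernel).withDensity (fun p => ENNReal.ofReal (1 - a.discloseProb p.2))).fst

/-- The intermediary's expected revenue. -/
def Assessment.revenue (a : Assessment) (T : UnbiasedTest F) (φ : Fees) : ℝ :=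
  a.testProb * (φ.testing + φ.disclosure * ∫ s, a.discloseProb s ∂T.scoreLaw)

/-- Perfect Bayesian equilibrium of the game induced by the test-fee structure `(T, φ)`. -/
structure IsPBE (T : UnbiasedTest F) (φ : Fees) (a : Assessment) : Prop where
  /-- The agent's strategy is a behavioral strategy. -/
  testProb_mem : a.testProb ∈ Set.Icc (0 : ℝ) 1
  discloseProb_mem : ∀ s, a.discloseProb s ∈ Set.Icc (0 : ℝ) 1
  discloseProb_measurable : Measurable a.discloseProb
  /-- Beliefs are probability distributions on the set of possible asset values. -/
  belief_prob : ∀ i, ∀ m ∈ T.messages, IsProbabilityMeasure (a.belief i m)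
  belief_support : ∀ i, ∀ m ∈ T.messages, a.belief i m F.supportᶜ = 0
  /-- The buyers share the same beliefs, on and off the path of play. -/
  belief_common : ∀ m ∈ T.messages, a.belief 0 m = a.belief 1 m
  /-- A disclosed score leads to the Bayesian posterior given that score, on and off the path;
  the posterior is determined up to a null set of scores, and its mean is the score throughout. -/
  belief_score : ∀ i, ∀ᵐ s ∂T.scoreLaw, a.belief i (some s) = posterior T.kernel F s
  belief_score_mean : ∀ i, ∀ s ∈ T.scores, ∫ θ, θ ∂(a.belief i (some s)) = s
  /-- Bayes' rule at the null message (void if the null message has probability zero). -/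
  belief_null : ∀ i, a.nullLaw T Set.univ • a.belief i none = a.nullLaw T
  /-- An unexpected null message cannot signal more than the agent knows: the buyers believe that
  with some probability the asset is untested, and otherwise that some score was concealed. -/
  belief_null_off_path : ∀ i, a.nullLaw T = 0 →
    ∃ α ∈ Set.Icc (0 : ℝ) 1, ∃ η : Measure ℝ, IsProbabilityMeasure η ∧ η T.scoresᶜ = 0 ∧
      a.belief i none = ENNReal.ofReal (1 - α) • F +
        ENNReal.ofReal α • η.bind (fun s => a.belief i (some s))
  /-- Sequential rationality of the buyers. -/
  bid_optimal : ∀ m ∈ T.messages, ∀ b : ℝ,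
    buyerPayoff (a.belief 0 m) b (a.bid 1 m) ≤
        buyerPayoff (a.belief 0 m) (a.bid 0 m) (a.bid 1 m) ∧
      buyerPayoff (a.belief 1 m) b (a.bid 0 m) ≤
        buyerPayoff (a.belief 1 m) (a.bid 1 m) (a.bid 0 m)
  /-- Sequential rationality of the agent after each score. -/
  disclose_optimal : ∀ s ∈ T.scores, ∀ d ∈ Set.Icc (0 : ℝ) 1,
    a.disclosurePayoff φ s d ≤ a.disclosurePayoff φ s (a.discloseProb s)
  /-- Sequential rationality of the agent's testing decision. -/
  test_optimal : ∀ t ∈ Set.Icc (0 : ℝ) 1, a.agentPayoff T φ t ≤ a.agentPayoff T φ a.testProb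

/-- The revenue guarantee of a test-fee structure: its lowest revenue across equilibria. -/
def revenueGuarantee (T : UnbiasedTest F) (φ : Fees) : EReal :=
  ⨅ (a : Assessment) (_ : IsPBE T φ a), ((a.revenue T φ : ℝ) : EReal)

end Game

/-- The maximal revenue guarantee: the supremum of the revenue guarantees over all test-fee
structures. -/
def maxRevenueGuarantee (F : Measure ℝ) [IsProbabilityMeasure F] : EReal :=
  ⨆ (T : UnbiasedTest F) (φ : Fees), revenueGuarantee T φ

/-! ### Robustly optimal test-fee structures -/

/-- The expected value of the asset. -/
def priorMean (F : Measure ℝ) : ℝ := ∫ θ, θ ∂F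

/-- `G` is a mean-preserving contraction of `F` on `[θl, θh]`. -/
structure IsMPC (θl θh : ℝ) (F G : Measure ℝ) : Prop where
  prob : IsProbabilityMeasure G
  support_subset : G.support ⊆ Set.Icc θl θh
  le : ∀ x ∈ Set.Icc θl θh, ∫ s in θl..x, cdf G s ≤ ∫ s in θl..x, cdf F s
  eq : ∫ s in θl..θh, cdf G s = ∫ s in θl..θh, cdf F s

/-- The lowest score in the support of `G`. -/
def lowestScore (G : Measure ℝ) : ℝ := sInf G.support

open Classical in
/-- `E_G[s | s ≤ τ]` for `τ` at least the lowest score. If `{s ≤ τ}` has probability zero, then `τ`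
is the lowest score, and so is the conditional expectation, by continuity. -/
def meanBelow (G : Measure ℝ) (τ : ℝ) : ℝ :=
  if G (Set.Iic τ) = 0 then lowestScore G else ⨍ s in Set.Iic τ, s ∂G

/-- Weak participation constraint, with `μ` the expected value of the asset. -/
def WeakParticipation (μ θh : ℝ) (G : Measure ℝ) (φ : Fees) : Prop :=
  φ.testing ≤ ∫ s in Set.Ioc (μ + φ.disclosure) θh, (s - (μ + φ.disclosure)) ∂G

/-- `τ` is a weak-highest equilibrium threshold of the test-fee structure `(G, φ)`. -/
def IsWeakHighestThreshold (G : Measure ℝ) (φ : Fees) (τ : ℝ) : Prop :=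
  lowestScore G ≤ τ ∧ τ - φ.disclosure = meanBelow G τ ∧
    ∀ τ' > τ, meanBelow G τ' ≤ τ' - φ.disclosure

/-- Revenue when the asset is tested for sure and exactly the scores above `τ` are disclosed. -/
def thresholdRevenue (G : Measure ℝ) (φ : Fees) (τ : ℝ) : ℝ :=
  φ.testing + φ.disclosure * (1 - cdf G τ)

/-- The constraints of the relaxed problem. -/
def IsFeasible (θl θh : ℝ) (F G : Measure ℝ) (φ : Fees) (τ : ℝ) : Prop :=
  IsMPC θl θh F G ∧ WeakParticipation (priorMean F) θh G φ ∧ IsWeakHighestThreshold G φ τ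

/-- `(G, φ)` is robustly optimal: with some threshold it solves the relaxed problem. -/
def IsRobustlyOptimal (θl θh : ℝ) (F G : Measure ℝ) (φ : Fees) : Prop :=
  ∃ τ, IsFeasible θl θh F G φ τ ∧
    ∀ G' φ' τ', IsFeasible θl θh F G' φ' τ' → thresholdRevenue G' φ' τ' ≤ thresholdRevenue G φ τ

/-- The step-exponential-step class, with `μ` the expected value of the asset. -/
def IsStepExpStep (μ : ℝ) (G : Measure ℝ) (φ : Fees) : Prop :=
  ∃ g τ₀ τ₁ τ₂ τ₃ : ℝ, g ∈ Set.Icc (0 : ℝ) 1 ∧ τ₀ < τ₁ ∧ τ₁ < τ₂ ∧ τ₂ ≤ τ₃ ∧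
    (∀ s < τ₀, cdf G s = 0) ∧
    (∀ s ∈ Set.Ico τ₀ τ₁, cdf G s = g) ∧
    (∀ s ∈ Set.Ico τ₁ τ₂, cdf G s = g * Real.exp ((s - τ₁) / (τ₁ - τ₀))) ∧
    (∀ s ∈ Set.Ico τ₂ τ₃, cdf G s = g * Real.exp ((τ₂ - τ₁) / (τ₁ - τ₀))) ∧
    (∀ s, τ₃ ≤ s → cdf G s = 1) ∧
    φ.disclosure = τ₁ - τ₀ ∧
    φ.testing =
      (1 - g * Real.exp ((τ₂ - τ₁) / φ.disclosure)) * (τ₃ - (μ + φ.disclosure))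

end

/-! Write `H(x) = E_G[(x - s)⁺]` for the integrated CDF, `μ` for the prior mean and `d` for the
disclosure fee. `H` is convex with right derivative `G`, and contraction of the prior means equal
means and `H ≤ H_F`. Since `E_G[s | s ≤ τ] = τ - H(τ)/G(τ)`, the threshold conditions read `d G(τ) =
H(τ)` and `d G ≤ H` beyond `τ`, and participation reads `t ≤ H(μ + d) - d`. Hence revenue is at most
`H(μ + d) - H(τ)`. As `G` is the slope of `H`, the threshold condition says that `H` grows at rate
at most `1/d` beyond `τ` (`integratedCDF_growth`).

Existence: replace `H` by its tangent at `μ + d`, followed leftwards until its height is `d` times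
its slope, then by the slowest descent that the growth bound allows, an exponential, down to `τ`,
then by a line to zero. The result lies below `H`, so it still contracts the prior, and it does not
lower revenue (`IsTopThreshold.exists_isCandidate`). It is the integrated CDF of a
step-exponential-step law, and four real parameters in a compact set remain.

Fee signs: feasibility excludes `d < 0`, and `d = 0` yields at most `H_F(μ)`. An exponential law
built on the tangent to `H_F` at `μ` does strictly better (`exists_isFeasible_gt`). At an optimum
participation binds, so the testing fee is the option value of scores above `μ + d`.

Bound: every test-fee structure has an equilibrium with low revenue: no testing, full disclosure, or
the highest threshold, according to the fees. In the last case the growth bound combined with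
tangents gives the stated number (`IsTopThreshold.revenue_bound`). For a binary prior every law with
mean `μ` on the interval is a score law (`exists_unbiasedTest_binary`). Under the exponential law
with no testing fee and a disclosure fee just below `θh - μ`, every equilibrium conceals at most the
bottom atom, and letting the fee rise attains the bound. -/

/-! ### The integrated distribution function -/

/-- The expected payoff `E_G[(x - s)⁺]`, which is the integral of the CDF of `G` up to `x`. -/
noncomputable def integratedCDF (G : Measure ℝ) (x : ℝ) : ℝ := ∫ s, max (x - s) 0 ∂G

section IntegratedCDF

variable {G : Measure ℝ} [IsProbabilityMeasure G] {a b : ℝ}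

lemma ae_mem_of_support_subset {G : Measure ℝ} {S : Set ℝ} (h : G.support ⊆ S) :
    ∀ᵐ s ∂G, s ∈ S :=
  Filter.mem_of_superset G.support_mem_ae h

lemma integrable_of_ae_mem_Icc (hG : ∀ᵐ s ∂G, s ∈ Set.Icc a b) : Integrable (fun s : ℝ => s) G := by
  refine Integrable.of_bound (C := max |a| |b|) (by fun_prop) ?_
  filter_upwards [hG] with s hs
  exact abs_le_max_abs_abs hs.1 hs.2

lemma integrable_max_sub (hG : ∀ᵐ s ∂G, s ∈ Set.Icc a b) (x : ℝ) :
    Integrable (fun s : ℝ => max (x - s) 0) G :=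
  ((integrable_const x).sub (integrable_of_ae_mem_Icc hG)).sup (integrable_const 0)

lemma integratedCDF_nonneg {G : Measure ℝ} (x : ℝ) : 0 ≤ integratedCDF G x :=
  integral_nonneg fun _ => le_max_right _ _

lemma integral_Iic_indicator (x : ℝ) (c : ℝ) :
    ∫ s, (Set.Iic x).indicator (fun _ => c) s ∂G = cdf G x * c := by
  rw [integral_indicator measurableSet_Iic, setIntegral_const, cdf_eq_real, smul_eq_mul]

/-- Convexity: the indicator of `s ≤ x` is a subgradient of `(x - s)⁺` in `x`, and integration
preserves this. Most later estimates are this inequality at a chosen pair of points. -/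
lemma integratedCDF_tangent (hG : ∀ᵐ s ∂G, s ∈ Set.Icc a b) (x y : ℝ) :
    integratedCDF G x + cdf G x * (y - x) ≤ integratedCDF G y := by
  rw [← integral_Iic_indicator, integratedCDF, integratedCDF,
    ← integral_add (integrable_max_sub hG x)
      ((integrable_const _).indicator measurableSet_Iic)]
  refine integral_mono ((integrable_max_sub hG x).add
    ((integrable_const _).indicator measurableSet_Iic)) (integrable_max_sub hG y) fun s => ?_
  by_cases hs : s ≤ x
  · simp only [Set.indicator, Set.mem_Iic, hs, if_true]
    rw [max_eq_left (by linarith)]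
    exact le_max_of_le_left (by linarith)
  · simp only [Set.indicator, Set.mem_Iic, hs, if_false]
    rw [max_eq_right (by linarith)]
    simp

lemma integratedCDF_mono (hG : ∀ᵐ s ∂G, s ∈ Set.Icc a b) : Monotone (integratedCDF G) := by
  intro x y hxy
  have h := integratedCDF_tangent hG x y
  nlinarith [cdf_nonneg G x]

lemma integratedCDF_sub_le (hG : ∀ᵐ s ∂G, s ∈ Set.Icc a b) {x y : ℝ} (hxy : x ≤ y) :
    integratedCDF G y ≤ integratedCDF G x + (y - x) := by
  have h := integratedCDF_tangent hG y x
  nlinarith [cdf_le_one G y]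

lemma integratedCDF_eq_zero {G : Measure ℝ} (hG : ∀ᵐ s ∂G, s ∈ Set.Icc a b) {x : ℝ} (hx : x ≤ a) :
    integratedCDF G x = 0 := by
  rw [integratedCDF, integral_congr_ae (g := fun _ => 0)]
  · simp
  · filter_upwards [hG] with s hs
    exact max_eq_right (by linarith [hs.1])

lemma integratedCDF_of_ge (hG : ∀ᵐ s ∂G, s ∈ Set.Icc a b) {x : ℝ} (hx : b ≤ x) :
    integratedCDF G x = x - ∫ s, s ∂G := by
  rw [integratedCDF, integral_congr_ae (g := fun s => x - s)]
  · rw [integral_sub (integrable_const x) (integrable_of_ae_mem_Icc hG)]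
    simp
  · filter_upwards [hG] with s hs
    exact max_eq_left (by linarith [hs.2])

lemma sub_mean_le_integratedCDF (hG : ∀ᵐ s ∂G, s ∈ Set.Icc a b) (x : ℝ) :
    x - ∫ s, s ∂G ≤ integratedCDF G x := by
  have : x - ∫ s, s ∂G = ∫ s, (x - s) ∂G := by
    rw [integral_sub (integrable_const x) (integrable_of_ae_mem_Icc hG)]
    simp
  rw [this]
  exact integral_mono ((integrable_const x).sub (integrable_of_ae_mem_Icc hG))
    (integrable_max_sub hG x) fun s => le_max_left _ _

/-- Put-call parity. It expresses the option value of testing through the integrated CDF. -/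
lemma integral_max_sub_eq (hG : ∀ᵐ s ∂G, s ∈ Set.Icc a b) (x : ℝ) :
    ∫ s, max (s - x) 0 ∂G = integratedCDF G x + (∫ s, s ∂G) - x := by
  have h : (fun s : ℝ => max (s - x) 0) = fun s => max (x - s) 0 + (s - x) := by
    funext s
    rcases le_total s x with h | h
    · rw [max_eq_right (by linarith), max_eq_left (by linarith)]; ring
    · rw [max_eq_left (by linarith), max_eq_right (by linarith)]; ring
  rw [h, integral_add (integrable_max_sub hG x)
    (g := fun s => s - x) ((integrable_of_ae_mem_Icc hG).sub (integrable_const x)),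
    integral_sub (integrable_of_ae_mem_Icc hG) (integrable_const x), integratedCDF]
  simp
  ring

lemma cdf_eq_one_of_ae_le (hG : ∀ᵐ s ∂G, s ∈ Set.Icc a b) {x : ℝ} (hx : b ≤ x) :
    cdf G x = 1 := by
  have h : G (Set.Iic x) = 1 := by
    rw [← prob_compl_eq_zero_iff measurableSet_Iic]
    have h' : ∀ᵐ s ∂G, s ∈ Set.Iic x := hG.mono fun s hs => hs.2.trans hx
    exact h'
  rw [cdf_eq_real, measureReal_def, h, ENNReal.toReal_one]

lemma continuous_integratedCDF (hG : ∀ᵐ s ∂G, s ∈ Set.Icc a b) : Continuous (integratedCDF G) := by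
  refine LipschitzWith.continuous (K := 1) (LipschitzWith.of_le_add fun x y => ?_)
  rcases le_total x y with h | h
  · exact (integratedCDF_mono hG h).trans (le_add_of_nonneg_right dist_nonneg)
  · rw [Real.dist_eq, abs_of_nonneg (by linarith)]
    exact integratedCDF_sub_le hG h

/-- The tangents at `x` and at `y > x` squeeze the slope between the two CDF values, and the CDF is
right continuous. At an atom only this one-sided derivative is available. -/
lemma hasDerivWithinAt_integratedCDF (hG : ∀ᵐ s ∂G, s ∈ Set.Icc a b) (x : ℝ) :
    HasDerivWithinAt (integratedCDF G) (cdf G x) (Set.Ioi x) x := by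
  rw [hasDerivWithinAt_iff_tendsto_slope' (by simp)]
  have hr : Filter.Tendsto (cdf G) (nhdsWithin x (Set.Ioi x)) (nhds (cdf G x)) :=
    ((cdf G).right_continuous x).mono_left (nhdsWithin_mono _ Set.Ioi_subset_Ici_self)
  refine tendsto_of_tendsto_of_tendsto_of_le_of_le' tendsto_const_nhds hr ?_ ?_
  · filter_upwards [self_mem_nhdsWithin] with y hy
    have hy' : 0 < y - x := sub_pos.2 hy
    rw [slope_def_field, le_div_iff₀ hy']
    linarith [integratedCDF_tangent hG x y]
  · filter_upwards [self_mem_nhdsWithin] with y hy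
    have hy' : 0 < y - x := sub_pos.2 hy
    rw [slope_def_field, div_le_iff₀ hy']
    linarith [integratedCDF_tangent hG y x]

lemma intervalIntegral_cdf (hG : ∀ᵐ s ∂G, s ∈ Set.Icc a b) (x : ℝ) :
    ∫ s in a..x, cdf G s = integratedCDF G x := by
  rw [intervalIntegral.integral_eq_sub_of_hasDeriv_right
    (continuous_integratedCDF hG).continuousOn
    (fun y _ => hasDerivWithinAt_integratedCDF hG y)
    ((monotone_cdf G).intervalIntegrable),
    integratedCDF_eq_zero hG le_rfl, sub_zero]

/-- The exponential growth bound: if `H ≥ d H'` to the right of `τ`, then `H` grows at most at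
rate `1 / d` there. -/
lemma integratedCDF_growth (hG : ∀ᵐ s ∂G, s ∈ Set.Icc a b) {d τ y : ℝ} (hd : 0 < d)
    (hτ : ∀ x > τ, d * cdf G x ≤ integratedCDF G x) {x : ℝ} (hx : τ ≤ x) (hxy : x ≤ y) :
    integratedCDF G y * Real.exp (-((y - x) / d)) ≤ integratedCDF G x := by
  -- An Euler step in place of a differential inequality: the tangent at `v`, whose slope is at most
  -- `H(v) / d`, is read at `u`. Composing `n` equal steps gives `(1 - c/n)^n`, which tends to the
  -- exponential.
  have step : ∀ u v, τ ≤ u → u ≤ v →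
      integratedCDF G v * (1 - (v - u) / d) ≤ integratedCDF G u := by
    intro u v hu huv
    rcases eq_or_lt_of_le huv with rfl | huv
    · simp
    have h1 := integratedCDF_tangent hG v u
    have h2 := hτ v (hu.trans_lt huv)
    have h3 : integratedCDF G v * ((v - u) / d) ≥ cdf G v * (v - u) := by
      rw [mul_div_assoc', ge_iff_le, le_div_iff₀ hd]
      nlinarith
    linarith
  have hlim : Filter.Tendsto
      (fun n : ℕ => integratedCDF G y * (1 + (-((y - x) / d)) / n) ^ n) Filter.atTop
      (nhds (integratedCDF G y * Real.exp (-((y - x) / d)))) :=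
    (Real.tendsto_one_add_div_pow_exp _).const_mul _
  refine le_of_tendsto hlim ?_
  -- For `n` this large the factor of one step is nonnegative, so the inequalities can be
  -- multiplied.
  obtain ⟨N, hN⟩ := exists_nat_gt ((y - x) / d)
  filter_upwards [Filter.eventually_ge_atTop (max N 1)] with n hn
  have hn1 : (1 : ℝ) ≤ n := by exact_mod_cast (le_max_right N 1).trans hn
  have hn0 : (0 : ℝ) < n := by linarith
  have hnN : (y - x) / d < n := hN.trans_le (by exact_mod_cast (le_max_left N 1).trans hn)
  have hq : 0 ≤ 1 + (-((y - x) / d)) / n := by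
    have : (y - x) / d / n ≤ 1 := by rw [div_le_one hn0]; exact hnN.le
    rw [neg_div]; linarith
  have key : ∀ k : ℕ, k ≤ n → integratedCDF G y * (1 + (-((y - x) / d)) / n) ^ k ≤
      integratedCDF G (y - k * ((y - x) / n)) := by
    intro k
    induction k with
    | zero => intro _; simp
    | succ k ih =>
      intro hk
      have ih' := ih (by omega)
      have hkn : ((k : ℝ) + 1) * ((y - x) / n) ≤ y - x := by
        rw [mul_div_assoc', div_le_iff₀ hn0]
        have : ((k : ℝ) + 1) ≤ n := by exact_mod_cast hk
        nlinarith
      have hstep : 0 ≤ (y - x) / n := div_nonneg (by linarith) hn0.le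
      have := step (y - (k + 1) * ((y - x) / n)) (y - k * ((y - x) / n)) (by linarith)
        (by nlinarith)
      push_cast
      refine le_trans ?_ this
      rw [pow_succ, ← mul_assoc]
      have e : 1 - (y - k * ((y - x) / n) - (y - (k + 1) * ((y - x) / n))) / d =
          1 + (-((y - x) / d)) / n := by
        field_simp
        ring
      rw [e]
      exact mul_le_mul_of_nonneg_right ih' hq
  have := key n le_rfl
  rwa [mul_div_cancel₀ _ hn0.ne', sub_sub_cancel] at this

end IntegratedCDF

/-! ### Thresholds and feasibility in terms of integrated distribution functions -/

section Threshold

variable {G : Measure ℝ} [IsProbabilityMeasure G] {a b : ℝ}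

lemma measure_Iic_ne_zero_iff (x : ℝ) : G (Set.Iic x) ≠ 0 ↔ 0 < cdf G x := by
  rw [← ofReal_cdf]
  simp

lemma integratedCDF_eq_setIntegral {G : Measure ℝ} (x : ℝ) :
    integratedCDF G x = ∫ s in Set.Iic x, (x - s) ∂G := by
  rw [← integral_indicator measurableSet_Iic, integratedCDF]
  congr 1
  funext s
  by_cases hs : s ≤ x
  · simp [Set.indicator, hs]
  · simp [Set.indicator, hs, (not_le.1 hs).le]

/-- The average of `x - s` over the scores below `x` is `H(x) / G(x)`. This makes the threshold
conditions linear in `H` and `G`. -/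
lemma meanBelow_eq (hG : ∀ᵐ s ∂G, s ∈ Set.Icc a b) {x : ℝ} (hx : 0 < cdf G x) :
    meanBelow G x = x - integratedCDF G x / cdf G x := by
  have h0 : G (Set.Iic x) ≠ 0 := (measure_Iic_ne_zero_iff x).2 hx
  have hi := integrable_of_ae_mem_Icc hG
  rw [meanBelow, if_neg h0, setAverage_eq, integratedCDF_eq_setIntegral,
    integral_sub (integrable_const _) hi.integrableOn, ← cdf_eq_real]
  simp only [integral_const, smul_eq_mul, measureReal_restrict_apply MeasurableSet.univ,
    Set.univ_inter, ← cdf_eq_real]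
  field_simp
  ring

lemma sub_le_meanBelow_iff (hG : ∀ᵐ s ∂G, s ∈ Set.Icc a b) {x d : ℝ} (hx : 0 < cdf G x) :
    meanBelow G x ≤ x - d ↔ d * cdf G x ≤ integratedCDF G x := by
  rw [meanBelow_eq hG hx, ← le_div_iff₀ hx]
  constructor <;> intro h <;> linarith

lemma sub_eq_meanBelow_iff (hG : ∀ᵐ s ∂G, s ∈ Set.Icc a b) {x d : ℝ} (hx : 0 < cdf G x) :
    x - d = meanBelow G x ↔ d * cdf G x = integratedCDF G x := by
  rw [meanBelow_eq hG hx, ← eq_div_iff hx.ne']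
  constructor <;> intro h <;> linarith

lemma cdf_pos_of_lowestScore_lt (hG : G.support ⊆ Set.Icc a b) {x : ℝ} (hx : lowestScore G < x) :
    0 < cdf G x := by
  obtain ⟨s, hs, hsx⟩ := (csInf_lt_iff ⟨a, fun s hs => (hG hs).1⟩
    (Measure.nonempty_support (IsProbabilityMeasure.ne_zero G))).1 hx
  rw [← measure_Iic_ne_zero_iff]
  exact (Measure.mem_support_iff_forall s |>.1 hs _ (Iic_mem_nhds hsx)).ne'

lemma lowestScore_le_of_cdf_pos (hG : G.support ⊆ Set.Icc a b) {x : ℝ} (hx : 0 < cdf G x) :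
    lowestScore G ≤ x := by
  obtain ⟨s, hs, hs'⟩ := Measure.nonempty_inter_support_of_pos
    (pos_iff_ne_zero.2 ((measure_Iic_ne_zero_iff x).2 hx))
  exact (csInf_le ⟨a, fun s hs => (hG hs).1⟩ hs').trans hs

/-- A threshold condition without the conventions at the lowest score. -/
structure IsTopThreshold (G : Measure ℝ) (d τ : ℝ) : Prop where
  nonneg : 0 ≤ d
  eq : d * cdf G τ = integratedCDF G τ
  le : ∀ x > τ, d * cdf G x ≤ integratedCDF G x
  pos : 0 < d → 0 < cdf G τ

/-- The convention for `meanBelow` matters only if no mass lies at or below `τ`; then `τ` is the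
lowest score and the fee is zero. Otherwise the fee is `H(τ) / G(τ) ≥ 0`. So the relaxed problem
admits no negative disclosure fee. -/
lemma IsWeakHighestThreshold.isTopThreshold (hG : G.support ⊆ Set.Icc a b) {φ : Fees} {τ : ℝ}
    (h : IsWeakHighestThreshold G φ τ) : IsTopThreshold G φ.disclosure τ := by
  obtain ⟨h1, h2, h3⟩ := h
  have hae := ae_mem_of_support_subset hG
  have hle : ∀ x > τ, φ.disclosure * cdf G x ≤ integratedCDF G x := fun x hx =>
    (sub_le_meanBelow_iff hae (cdf_pos_of_lowestScore_lt hG (h1.trans_lt hx))).1 (h3 x hx)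
  rcases (cdf_nonneg G τ).eq_or_lt with h0 | h0
  · have hz : G (Set.Iic τ) = 0 := by
      by_contra hne
      exact ((measure_Iic_ne_zero_iff τ).1 hne).ne h0
    have hτ : τ = lowestScore G := by
      refine le_antisymm (not_lt.1 fun hlt => ?_) h1
      exact (cdf_pos_of_lowestScore_lt hG hlt).ne h0
    have hd : φ.disclosure = 0 := by
      rw [meanBelow, if_pos hz, ← hτ] at h2
      linarith
    refine ⟨hd.ge, ?_, hle, fun h => absurd hd h.ne'⟩
    rw [integratedCDF_eq_setIntegral, setIntegral_measure_zero _ hz, hd, zero_mul]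
  · have heq := (sub_eq_meanBelow_iff hae h0).1 h2
    refine ⟨?_, heq, hle, fun _ => h0⟩
    by_contra hneg
    have := integratedCDF_nonneg (G := G) τ
    nlinarith

lemma IsTopThreshold.isWeakHighestThreshold (hG : G.support ⊆ Set.Icc a b) {φ : Fees} {τ : ℝ}
    (h : IsTopThreshold G φ.disclosure τ) (hd : 0 < φ.disclosure) :
    IsWeakHighestThreshold G φ τ := by
  have hae := ae_mem_of_support_subset hG
  have hp := h.pos hd
  refine ⟨lowestScore_le_of_cdf_pos hG hp, (sub_eq_meanBelow_iff hae hp).2 h.eq, fun x hx => ?_⟩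
  exact (sub_le_meanBelow_iff hae (hp.trans_le (monotone_cdf G hx.le))).2 (h.le x hx)

lemma setIntegral_Ioc_sub_eq (hG : ∀ᵐ s ∂G, s ∈ Set.Icc a b) (x : ℝ) :
    ∫ s in Set.Ioc x b, (s - x) ∂G = integratedCDF G x + (∫ s, s ∂G) - x := by
  rw [← integral_max_sub_eq hG, ← integral_indicator measurableSet_Ioc]
  refine integral_congr_ae ?_
  filter_upwards [hG] with s hs
  by_cases h : x < s
  · simp [Set.indicator, h, hs.2, h.le]
  · simp [Set.indicator, h, not_lt.1 h]

/-- Positivity of the option value of scores above `x`. -/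
lemma setIntegral_Ioc_sub_pos_iff (hG : ∀ᵐ s ∂G, s ∈ Set.Icc a b) (x : ℝ) :
    0 < ∫ s in Set.Ioc x b, (s - x) ∂G ↔ 0 < G (Set.Ioc x b) := by
  have hi : IntegrableOn (fun s : ℝ => s - x) (Set.Ioc x b) G :=
    ((integrable_of_ae_mem_Icc hG).sub (integrable_const x)).integrableOn
  rw [setIntegral_pos_iff_support_of_nonneg_ae _ hi]
  · have : Function.support (fun s : ℝ => s - x) ∩ Set.Ioc x b = Set.Ioc x b := by
      refine Set.inter_eq_right.2 fun s hs => ?_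
      exact (sub_pos.2 hs.1).ne'
    rw [this]
  · filter_upwards [ae_restrict_mem measurableSet_Ioc] with s hs
    exact (sub_pos.2 hs.1).le

end Threshold

/-! ### Mean-preserving contractions of the prior. -/

section Prior

variable {F : Measure ℝ} [IsProbabilityMeasure F] {θl θh : ℝ}

lemma support_subset_Icc {F : Measure ℝ} (hl : IsLeast F.support θl) (hh : IsGreatest F.support θh) :
    F.support ⊆ Set.Icc θl θh := fun _ hs => ⟨hl.2 hs, hh.2 hs⟩

lemma lt_priorMean (hθ : θl < θh) (hl : IsLeast F.support θl) (hh : IsGreatest F.support θh) :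
    θl < priorMean F := by
  have hae := ae_mem_of_support_subset (support_subset_Icc hl hh)
  have hi := integrable_of_ae_mem_Icc hae
  have : 0 < ∫ s, (s - θl) ∂F := by
    rw [integral_pos_iff_support_of_nonneg_ae (f := fun s => s - θl) _
      (hi.sub (integrable_const _))]
    · refine (Measure.mem_support_iff_forall θh |>.1 hh.1 _ (Ioi_mem_nhds hθ)).trans_le
        (measure_mono fun s hs => (sub_pos.2 hs).ne')
    · filter_upwards [hae] with s hs using sub_nonneg.2 hs.1
  rw [integral_sub hi (integrable_const _)] at this
  simp at this
  exact this

lemma priorMean_lt (hθ : θl < θh) (hl : IsLeast F.support θl) (hh : IsGreatest F.support θh) :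
    priorMean F < θh := by
  have hae := ae_mem_of_support_subset (support_subset_Icc hl hh)
  have hi := integrable_of_ae_mem_Icc hae
  have : 0 < ∫ s, (θh - s) ∂F := by
    rw [integral_pos_iff_support_of_nonneg_ae (f := fun s => θh - s) _
      ((integrable_const _).sub hi)]
    · refine (Measure.mem_support_iff_forall θl |>.1 hl.1 _ (Iio_mem_nhds hθ)).trans_le
        (measure_mono fun s hs => (sub_pos.2 hs).ne')
    · filter_upwards [hae] with s hs using sub_nonneg.2 hs.2
  rw [integral_sub (integrable_const _) hi] at this
  simp at this
  exact this

lemma isMPC_of_integratedCDF_le {G : Measure ℝ} [IsProbabilityMeasure G]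
    (hF : F.support ⊆ Set.Icc θl θh) (hG : G.support ⊆ Set.Icc θl θh)
    (hmean : ∫ s, s ∂G = priorMean F)
    (hle : ∀ x ∈ Set.Icc θl θh, integratedCDF G x ≤ integratedCDF F x) : IsMPC θl θh F G := by
  have hF' := ae_mem_of_support_subset hF
  have hG' := ae_mem_of_support_subset hG
  refine ⟨inferInstance, hG, fun x hx => ?_, ?_⟩
  · rw [intervalIntegral_cdf hF', intervalIntegral_cdf hG']
    exact hle x hx
  · rw [intervalIntegral_cdf hF', intervalIntegral_cdf hG', integratedCDF_of_ge hF' le_rfl,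
      integratedCDF_of_ge hG' le_rfl, hmean, priorMean]

namespace IsMPC

variable {G : Measure ℝ} (h : IsMPC θl θh F G)
include h

omit [IsProbabilityMeasure F] in
lemma ae_mem : ∀ᵐ s ∂G, s ∈ Set.Icc θl θh := ae_mem_of_support_subset h.support_subset

lemma mean_eq (hF : F.support ⊆ Set.Icc θl θh) : ∫ s, s ∂G = priorMean F := by
  have := h.prob
  have hF' := ae_mem_of_support_subset hF
  have := h.eq
  rw [intervalIntegral_cdf hF', intervalIntegral_cdf h.ae_mem, integratedCDF_of_ge hF' le_rfl,
      integratedCDF_of_ge h.ae_mem le_rfl] at this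
  rw [priorMean]
  linarith

lemma integratedCDF_le (hF : F.support ⊆ Set.Icc θl θh) {x : ℝ} (hx : x ∈ Set.Icc θl θh) :
    integratedCDF G x ≤ integratedCDF F x := by
  have := h.prob
  have := h.le x hx
  rwa [intervalIntegral_cdf (ae_mem_of_support_subset hF), intervalIntegral_cdf h.ae_mem] at this

end IsMPC

end Prior

/-! ### Revenue bounds at a threshold. -/

section Bounds

variable {G : Measure ℝ} [IsProbabilityMeasure G] {a b d τ : ℝ}

/-- Revenue at a threshold when the participation constraint binds. -/
lemma IsTopThreshold.revenue_le {G : Measure ℝ} (h : IsTopThreshold G d τ) {t : ℝ}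
    (ht : t ≤ integratedCDF G ((∫ s, s ∂G) + d) - d) :
    t + d * (1 - cdf G τ) ≤ integratedCDF G ((∫ s, s ∂G) + d) - integratedCDF G τ := by
  have := h.eq
  linarith

/-- The null price `τ - d` is an average of scores, hence at least `a`; formally, the tangent at `τ`
is read at `a`. -/
lemma IsTopThreshold.add_le (h : IsTopThreshold G d τ) (hG : ∀ᵐ s ∂G, s ∈ Set.Icc a b)
    (hd : 0 < d) : a + d ≤ τ := by
  have h1 := integratedCDF_tangent hG τ a
  rw [integratedCDF_eq_zero hG le_rfl, ← h.eq] at h1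
  have := h.pos hd
  nlinarith

lemma IsTopThreshold.disclosure_le (h : IsTopThreshold G d τ) (hG : ∀ᵐ s ∂G, s ∈ Set.Icc a b)
    (hτ : τ < b) : (∫ s, s ∂G) + d ≤ b := by
  have h1 := h.le b hτ
  rw [cdf_eq_one_of_ae_le hG le_rfl, integratedCDF_of_ge hG le_rfl] at h1
  linarith

lemma lt_mean_add_of_revenue_pos (hG : ∀ᵐ s ∂G, s ∈ Set.Icc a b)
    (hpos : 0 < integratedCDF G ((∫ s, s ∂G) + d) - integratedCDF G τ) :
    τ < (∫ s, s ∂G) + d := by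
  by_contra hle
  have := integratedCDF_mono hG (not_lt.1 hle)
  linarith

/-- If the threshold exceeds all scores then no positive revenue is possible. -/
lemma IsTopThreshold.lt_top (h : IsTopThreshold G d τ) (hG : ∀ᵐ s ∂G, s ∈ Set.Icc a b)
    (hpos : 0 < integratedCDF G ((∫ s, s ∂G) + d) - integratedCDF G τ) : τ < b := by
  by_contra hle
  have h1 := h.eq
  rw [cdf_eq_one_of_ae_le hG (not_lt.1 hle), integratedCDF_of_ge hG (not_lt.1 hle)] at h1
  have h2 := lt_mean_add_of_revenue_pos hG hpos
  linarith

/-- The upper bound on revenue at a threshold. -/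
lemma IsTopThreshold.revenue_bound (h : IsTopThreshold G d τ) (hG : ∀ᵐ s ∂G, s ∈ Set.Icc a b)
    (hd : 0 < d) {μ : ℝ} (hμ : ∫ s, s ∂G = μ) (haμ : a < μ) (hμb : μ < b) :
    integratedCDF G (μ + d) - integratedCDF G τ ≤
      (b - μ) * (1 - Real.exp ((a - μ) / (b - μ))) := by
  have hb : 0 < b - μ := by linarith
  have hk : 0 ≤ 1 - Real.exp ((a - μ) / (b - μ)) := by
    rw [sub_nonneg, Real.exp_le_one_iff]
    exact div_nonpos_of_nonpos_of_nonneg (by linarith) hb.le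
  rcases le_or_gt (integratedCDF G (μ + d) - integratedCDF G τ) 0 with h0 | h0
  · exact h0.trans (mul_nonneg hb.le hk)
  subst hμ
  set μ := ∫ s, s ∂G
  have hτb := h.lt_top hG h0
  have hcb := h.disclosure_le hG hτb
  have hτc := lt_mean_add_of_revenue_pos hG h0
  have haτ := h.add_le hG hd
  set A := integratedCDF G (μ + d)
  set p := cdf G (μ + d)
  have hp0 : 0 ≤ p := cdf_nonneg _ _
  set y := (μ - a) / (b - μ) with hy
  have hy0 : 0 < y := div_pos (by linarith) hb
  have hyk : (a - μ) / (b - μ) = -y := by rw [hy, ← neg_div, neg_sub]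
  rw [hyk] at hk ⊢
  set E := Real.exp (-y) with hE
  have hE0 : 0 < E := Real.exp_pos _
  -- The tangent at `μ + d`, read at the top, where `H(b) = b - μ`.
  have hA : A ≤ (b - μ) - p * (b - μ - d) := by
    have := integratedCDF_tangent hG (μ + d) b
    rw [integratedCDF_of_ge hG le_rfl] at this
    linarith
  -- the growth bound, evaluated at a well chosen point
  have hx : a + d + d * y ≤ μ + d := by
    have : d * y ≤ μ - a := by
      rw [hy, mul_div_assoc', div_le_iff₀ hb]
      nlinarith
    linarith
  -- Since `a + d ≤ τ`, the chosen point exceeds `τ` by at most `d * y`, so the growth bound loses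
  -- at most the factor `E`, the exponential of the target. The tangent at `μ + d` bounds the value
  -- at that point from below.
  have hτ : (A - p * (μ - a - d * y)) * E ≤ integratedCDF G τ := by
    have ht := integratedCDF_tangent hG (μ + d) (a + d + d * y)
    have hAx : A - p * (μ - a - d * y) ≤ integratedCDF G (a + d + d * y) := by
      refine le_trans (le_of_eq ?_) ht
      ring
    rcases le_total τ (a + d + d * y) with hle | hle
    · have hg := integratedCDF_growth hG hd h.le le_rfl hle
      have hEle : E ≤ Real.exp (-((a + d + d * y - τ) / d)) := by
        rw [hE, Real.exp_le_exp, neg_le_neg_iff, div_le_iff₀ hd]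
        linarith
      exact (mul_le_mul_of_nonneg_right hAx hE0.le).trans
        ((mul_le_mul_of_nonneg_left hEle (integratedCDF_nonneg _)).trans hg)
    · have hE1 : E ≤ 1 := by linarith
      refine (mul_le_mul_of_nonneg_right hAx hE0.le).trans ?_
      have := integratedCDF_mono hG hle
      have h0 := integratedCDF_nonneg (G := G) (a + d + d * y)
      nlinarith
  have hyE : y * E ≤ 1 - E := by
    have h1 := Real.add_one_le_exp y
    have h2 : E * Real.exp y = 1 := by rw [hE, ← Real.exp_add]; simp
    nlinarith
  have hmy : μ - a = (b - μ) * y := by rw [hy]; field_simp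
  have hfac : 0 ≤ p * (b - μ - d) := mul_nonneg hp0 (by linarith)
  -- As `μ - a = (b - μ) * y`, the error term is `p * (b - μ - d) * y * E`. Because `y * E ≤ 1 - E`,
  -- it is absorbed by the slack `p * (b - μ - d) * (1 - E)` left by `hA`.
  have h3 : A - integratedCDF G τ ≤ A * (1 - E) + p * (μ - a - d * y) * E := by nlinarith
  have h4 : A * (1 - E) ≤ ((b - μ) - p * (b - μ - d)) * (1 - E) :=
    mul_le_mul_of_nonneg_right hA hk
  have h5 : p * (μ - a - d * y) * E = p * (b - μ - d) * (y * E) := by rw [hmy]; ring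
  have h6 : p * (b - μ - d) * (y * E) ≤ p * (b - μ - d) * (1 - E) :=
    mul_le_mul_of_nonneg_left hyE hfac
  nlinarith

end Bounds

/-! ### Step-exponential-step distributions -/

/-- The projection of `x` to the exponential region `[τ₁, τ₂]`. -/
noncomputable def clampTo (τ₁ τ₂ x : ℝ) : ℝ := min (max x τ₁) τ₂

/-- The function that equals `g` up to `τ₁`, grows exponentially at rate `1 / d` on `[τ₁, τ₂]`,
and is constant from then on. -/
noncomputable def expSlope (g d τ₁ τ₂ x : ℝ) : ℝ := g * Real.exp ((clampTo τ₁ τ₂ x - τ₁) / d)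

/-- The antiderivative of `expSlope` that vanishes at `τ₁ - d`. -/
noncomputable def expLine (g d τ₁ τ₂ x : ℝ) : ℝ :=
  expSlope g d τ₁ τ₂ x * (d + (x - clampTo τ₁ τ₂ x))

section ExpLine

variable {g d τ₁ τ₂ τ₃ x : ℝ}

lemma clampTo_of_le (h12 : τ₁ ≤ τ₂) (hx : x ≤ τ₁) : clampTo τ₁ τ₂ x = τ₁ := by
  rw [clampTo, max_eq_right hx, min_eq_left h12]

lemma clampTo_of_mem (h1 : τ₁ ≤ x) (h2 : x ≤ τ₂) : clampTo τ₁ τ₂ x = x := by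
  rw [clampTo, max_eq_left h1, min_eq_left h2]

lemma clampTo_of_ge (h12 : τ₁ ≤ τ₂) (hx : τ₂ ≤ x) : clampTo τ₁ τ₂ x = τ₂ := by
  rw [clampTo, max_eq_left (h12.trans hx), min_eq_right hx]

lemma expSlope_of_le (h12 : τ₁ ≤ τ₂) (hx : x ≤ τ₁) : expSlope g d τ₁ τ₂ x = g := by
  simp [expSlope, clampTo_of_le h12 hx]

lemma expSlope_of_mem (h1 : τ₁ ≤ x) (h2 : x ≤ τ₂) :
    expSlope g d τ₁ τ₂ x = g * Real.exp ((x - τ₁) / d) := by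
  rw [expSlope, clampTo_of_mem h1 h2]

lemma expSlope_of_ge (h12 : τ₁ ≤ τ₂) (hx : τ₂ ≤ x) :
    expSlope g d τ₁ τ₂ x = g * Real.exp ((τ₂ - τ₁) / d) := by
  rw [expSlope, clampTo_of_ge h12 hx]

lemma expLine_of_le (h12 : τ₁ ≤ τ₂) (hx : x ≤ τ₁) :
    expLine g d τ₁ τ₂ x = g * (d + (x - τ₁)) := by
  rw [expLine, expSlope_of_le h12 hx, clampTo_of_le h12 hx]

lemma expLine_of_mem (h1 : τ₁ ≤ x) (h2 : x ≤ τ₂) :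
    expLine g d τ₁ τ₂ x = d * (g * Real.exp ((x - τ₁) / d)) := by
  rw [expLine, expSlope_of_mem h1 h2, clampTo_of_mem h1 h2]
  ring

lemma expLine_of_ge (h12 : τ₁ ≤ τ₂) (hx : τ₂ ≤ x) :
    expLine g d τ₁ τ₂ x = g * Real.exp ((τ₂ - τ₁) / d) * (d + (x - τ₂)) := by
  rw [expLine, expSlope_of_ge h12 hx, clampTo_of_ge h12 hx]

lemma expSlope_nonneg (hg : 0 ≤ g) : 0 ≤ expSlope g d τ₁ τ₂ x :=
  mul_nonneg hg (Real.exp_pos _).le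

lemma monotone_expSlope (hg : 0 ≤ g) (hd : 0 < d) : Monotone (expSlope g d τ₁ τ₂) := by
  intro x y hxy
  unfold expSlope clampTo
  gcongr

lemma continuous_expSlope (g d τ₁ τ₂ : ℝ) : Continuous (expSlope g d τ₁ τ₂) := by
  unfold expSlope clampTo
  fun_prop

lemma continuous_expLine (g d τ₁ τ₂ : ℝ) : Continuous (expLine g d τ₁ τ₂) := by
  unfold expLine expSlope clampTo
  fun_prop

lemma hasDerivWithinAt_expLine (hd : 0 < d) (h12 : τ₁ ≤ τ₂) (x : ℝ) :
    HasDerivWithinAt (expLine g d τ₁ τ₂) (expSlope g d τ₁ τ₂ x) (Set.Ioi x) x := by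
  rcases lt_or_ge x τ₁ with h1 | h1
  · rw [expSlope_of_le h12 h1.le]
    have : HasDerivAt (fun y => g * (d + (y - τ₁))) (g * 1) x :=
      (((hasDerivAt_id x).sub_const τ₁).const_add d).const_mul g
    rw [mul_one] at this
    refine this.hasDerivWithinAt.congr_of_eventuallyEq ?_ (expLine_of_le h12 h1.le)
    filter_upwards [mem_nhdsWithin_of_mem_nhds (Iio_mem_nhds h1)] with y hy
    exact expLine_of_le h12 hy.le
  rcases lt_or_ge x τ₂ with h2 | h2
  · rw [expSlope_of_mem h1 h2.le]
    have : HasDerivAt (fun y => d * (g * Real.exp ((y - τ₁) / d)))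
        (d * (g * (Real.exp ((x - τ₁) / d) * (1 / d)))) x :=
      ((((hasDerivAt_id x).sub_const τ₁).div_const d).exp.const_mul g).const_mul d
    have e : d * (g * (Real.exp ((x - τ₁) / d) * (1 / d))) = g * Real.exp ((x - τ₁) / d) := by
      field_simp
    rw [e] at this
    refine this.hasDerivWithinAt.congr_of_eventuallyEq ?_ (expLine_of_mem h1 h2.le)
    filter_upwards [mem_nhdsWithin_of_mem_nhds (Iio_mem_nhds h2), self_mem_nhdsWithin] with y hy hy'
    exact expLine_of_mem (h1.trans (le_of_lt hy')) hy.le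
  · rw [expSlope_of_ge h12 h2]
    have : HasDerivAt (fun y => g * Real.exp ((τ₂ - τ₁) / d) * (d + (y - τ₂)))
        (g * Real.exp ((τ₂ - τ₁) / d) * 1) x :=
      (((hasDerivAt_id x).sub_const τ₂).const_add d).const_mul _
    rw [mul_one] at this
    refine this.hasDerivWithinAt.congr_of_eventuallyEq ?_ (expLine_of_ge h12 h2)
    filter_upwards [self_mem_nhdsWithin] with y hy
    exact expLine_of_ge h12 (h2.trans (le_of_lt hy))

end ExpLine

/-- The parameters of a step-exponential-step distribution with mean `μ`. -/
structure StepExpParams (μ g d τ₁ τ₂ τ₃ : ℝ) : Prop where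
  g_pos : 0 < g
  d_pos : 0 < d
  h12 : τ₁ ≤ τ₂
  h23 : τ₂ ≤ τ₃
  top_le : g * Real.exp ((τ₂ - τ₁) / d) ≤ 1
  -- The final line of the integrated CDF meets the asymptote `x - μ` at `τ₃`.
  mean : g * Real.exp ((τ₂ - τ₁) / d) * (d + (τ₃ - τ₂)) = τ₃ - μ

/-- The CDF of a step-exponential-step distribution. -/
noncomputable def stepExpFun (g d τ₁ τ₂ τ₃ x : ℝ) : ℝ :=
  if x < τ₁ - d then 0 else if x < τ₃ then expSlope g d τ₁ τ₂ x else 1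

/-- The integrated CDF of a step-exponential-step distribution. -/
noncomputable def stepExpInt (μ g d τ₁ τ₂ τ₃ x : ℝ) : ℝ :=
  if x ≤ τ₁ - d then 0 else if x ≤ τ₃ then expLine g d τ₁ τ₂ x else x - μ

namespace StepExpParams

variable {μ g d τ₁ τ₂ τ₃ : ℝ} (h : StepExpParams μ g d τ₁ τ₂ τ₃)
include h

lemma bot_lt_top : τ₁ - d < τ₃ := by linarith [h.d_pos, h.h12, h.h23]

lemma expSlope_le_one (x : ℝ) : expSlope g d τ₁ τ₂ x ≤ 1 := by
  refine le_trans ?_ h.top_le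
  rw [← expSlope_of_ge h.h12 (le_max_right x τ₂)]
  exact monotone_expSlope h.g_pos.le h.d_pos (le_max_left x τ₂)

lemma monotone_stepExpFun : Monotone (stepExpFun g d τ₁ τ₂ τ₃) := by
  intro x y hxy
  unfold stepExpFun
  have h1 := monotone_expSlope (τ₁ := τ₁) (τ₂ := τ₂) h.g_pos.le h.d_pos hxy
  have h2 := h.expSlope_le_one x
  have h3 := expSlope_nonneg (d := d) (τ₁ := τ₁) (τ₂ := τ₂) (x := y) h.g_pos.le
  split_ifs <;> linarith

lemma stepExpFun_right_continuous (x : ℝ) :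
    ContinuousWithinAt (stepExpFun g d τ₁ τ₂ τ₃) (Set.Ici x) x := by
  have hbt := h.bot_lt_top
  rcases lt_or_ge x (τ₁ - d) with h0 | h0
  · refine (continuousWithinAt_const (b := (0 : ℝ))).congr_of_eventuallyEq ?_
      (by simp [stepExpFun, h0])
    filter_upwards [mem_nhdsWithin_of_mem_nhds (Iio_mem_nhds h0)] with y hy
    exact if_pos hy
  rcases lt_or_ge x τ₃ with h3 | h3
  · refine (continuous_expSlope g d τ₁ τ₂).continuousWithinAt.congr_of_eventuallyEq ?_
      (by simp [stepExpFun, h0.not_gt, h3])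
    filter_upwards [mem_nhdsWithin_of_mem_nhds (Iio_mem_nhds h3), self_mem_nhdsWithin] with y hy hy'
    rw [stepExpFun, if_neg (h0.trans hy').not_gt, if_pos (Set.mem_Iio.1 hy)]
  · refine (continuousWithinAt_const (b := (1 : ℝ))).congr_of_eventuallyEq ?_
      (by simp [stepExpFun, h0.not_gt, h3.not_gt])
    filter_upwards [self_mem_nhdsWithin] with y hy
    rw [stepExpFun, if_neg (h0.trans hy).not_gt, if_neg (h3.trans hy).not_gt]

lemma continuous_stepExpInt : Continuous (stepExpInt μ g d τ₁ τ₂ τ₃) := by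
  have hbt := h.bot_lt_top
  unfold stepExpInt
  refine Continuous.if_le continuous_const ?_ continuous_id continuous_const ?_
  · refine Continuous.if_le (continuous_expLine g d τ₁ τ₂) (by fun_prop) continuous_id
      continuous_const ?_
    intro x hx
    rw [hx, expLine_of_ge h.h12 h.h23, h.mean]
  · intro x hx
    rw [if_pos (by linarith), expLine_of_le h.h12 (by linarith [h.d_pos]), hx]
    ring

lemma hasDerivWithinAt_stepExpInt (x : ℝ) :
    HasDerivWithinAt (stepExpInt μ g d τ₁ τ₂ τ₃) (stepExpFun g d τ₁ τ₂ τ₃ x) (Set.Ioi x) x := by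
  have hbt := h.bot_lt_top
  rcases lt_or_ge x (τ₁ - d) with h0 | h0
  · rw [stepExpFun, if_pos h0]
    refine (hasDerivWithinAt_const x _ (0 : ℝ)).congr_of_eventuallyEq ?_ (if_pos h0.le)
    filter_upwards [mem_nhdsWithin_of_mem_nhds (Iio_mem_nhds h0)] with y hy
    exact if_pos (le_of_lt hy)
  rcases lt_or_ge x τ₃ with h3 | h3
  · rw [stepExpFun, if_neg h0.not_gt, if_pos h3]
    refine (hasDerivWithinAt_expLine h.d_pos h.h12 x).congr_of_eventuallyEq ?_ ?_
    · filter_upwards [mem_nhdsWithin_of_mem_nhds (Iio_mem_nhds h3), self_mem_nhdsWithin]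
        with y hy hy'
      rw [stepExpInt, if_neg (h0.trans_lt hy').not_ge, if_pos (le_of_lt hy)]
    · rcases h0.eq_or_lt with h0 | h0
      · rw [stepExpInt, if_pos h0.ge, expLine_of_le h.h12 (by linarith [h.d_pos]), ← h0]
        ring
      · rw [stepExpInt, if_neg h0.not_ge, if_pos h3.le]
  · rw [stepExpFun, if_neg h0.not_gt, if_neg h3.not_gt]
    refine ((hasDerivWithinAt_id x _).sub_const μ).congr_of_eventuallyEq ?_ ?_
    · filter_upwards [self_mem_nhdsWithin] with y hy
      rw [stepExpInt, if_neg (h0.trans_lt hy).not_ge, if_neg (h3.trans_lt hy).not_ge, id]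
    · rcases h3.eq_or_lt with h3 | h3
      · rw [stepExpInt, if_neg (by linarith), if_pos h3.ge, ← h3, expLine_of_ge h.h12 h.h23,
          h.mean, id]
      · rw [stepExpInt, if_neg (by linarith), if_neg h3.not_ge, id]

/-- The CDF of a step-exponential-step distribution, as a Stieltjes function. -/
noncomputable def stieltjes : StieltjesFunction ℝ where
  toFun := stepExpFun g d τ₁ τ₂ τ₃
  mono' := h.monotone_stepExpFun
  right_continuous' := h.stepExpFun_right_continuous

/-- The step-exponential-step distribution. -/
noncomputable def law : Measure ℝ := h.stieltjes.measure

lemma tendsto_stieltjes_atBot : Filter.Tendsto h.stieltjes Filter.atBot (nhds 0) := by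
  refine tendsto_const_nhds.congr' ?_
  filter_upwards [Filter.eventually_lt_atBot (τ₁ - d)] with x hx
  exact (if_pos hx).symm

lemma tendsto_stieltjes_atTop : Filter.Tendsto h.stieltjes Filter.atTop (nhds 1) := by
  refine tendsto_const_nhds.congr' ?_
  filter_upwards [Filter.eventually_ge_atTop τ₃] with x hx
  change 1 = stepExpFun g d τ₁ τ₂ τ₃ x
  rw [stepExpFun, if_neg (h.bot_lt_top.trans_le hx).not_gt, if_neg hx.not_gt]

lemma isProbabilityMeasure_law : IsProbabilityMeasure h.law :=
  h.stieltjes.isProbabilityMeasure h.tendsto_stieltjes_atBot h.tendsto_stieltjes_atTop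

lemma cdf_law (x : ℝ) : cdf h.law x = stepExpFun g d τ₁ τ₂ τ₃ x := by
  have := cdf_measure_stieltjesFunction _ h.tendsto_stieltjes_atBot h.tendsto_stieltjes_atTop
  rw [law, this]
  rfl

lemma ae_mem_law : ∀ᵐ s ∂h.law, s ∈ Set.Icc (τ₁ - d) τ₃ := by
  have := h.isProbabilityMeasure_law
  have h1 : ∀ᵐ s ∂h.law, s ∈ Set.Ici (τ₁ - d) := by
    rw [ae_iff]
    have e : {s : ℝ | s ∉ Set.Ici (τ₁ - d)} = Set.Iio (τ₁ - d) := by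
      ext; simp only [Set.mem_Ici, Set.mem_ofPred_eq, not_le, Set.mem_Iio]
    rw [e, law, StieltjesFunction.measure_Iio _ h.tendsto_stieltjes_atBot]
    have : Function.leftLim h.stieltjes (τ₁ - d) = 0 := by
      refine leftLim_eq_of_tendsto ?_
      refine tendsto_const_nhds.congr' ?_
      filter_upwards [self_mem_nhdsWithin] with x hx
      exact (if_pos hx).symm
    simp [this]
  have h2 : ∀ᵐ s ∂h.law, s ∈ Set.Iic τ₃ := by
    rw [ae_iff]
    refine (prob_compl_eq_zero_iff measurableSet_Iic).2 ?_
    rw [← ofReal_cdf, h.cdf_law, stepExpFun, if_neg h.bot_lt_top.not_gt, if_neg (lt_irrefl _)]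
    simp
  filter_upwards [h1, h2] with s hs1 hs2 using ⟨hs1, hs2⟩

lemma support_law_subset : h.law.support ⊆ Set.Icc (τ₁ - d) τ₃ :=
  Measure.support_subset_of_isClosed isClosed_Icc h.ae_mem_law

/-- Both sides vanish at `τ₁ - d` and are continuous with the CDF as right derivative. -/
lemma integratedCDF_law (x : ℝ) : integratedCDF h.law x = stepExpInt μ g d τ₁ τ₂ τ₃ x := by
  have := h.isProbabilityMeasure_law
  rw [← intervalIntegral_cdf h.ae_mem_law,
    intervalIntegral.integral_eq_sub_of_hasDeriv_right h.continuous_stepExpInt.continuousOn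
    (fun y _ => by rw [h.cdf_law]; exact h.hasDerivWithinAt_stepExpInt y)
    ((monotone_cdf h.law).intervalIntegrable)]
  simp [stepExpInt]

lemma mean_law : ∫ s, s ∂h.law = μ := by
  have := h.isProbabilityMeasure_law
  have h1 := integratedCDF_of_ge h.ae_mem_law (le_refl τ₃)
  rw [h.integratedCDF_law, stepExpInt, if_neg h.bot_lt_top.not_ge, if_pos le_rfl,
    expLine_of_ge h.h12 h.h23, h.mean] at h1
  linarith

lemma integratedCDF_law_of_mem {x : ℝ} (hx : τ₁ - d ≤ x) (hx3 : x ≤ τ₃) :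
    integratedCDF h.law x = expLine g d τ₁ τ₂ x := by
  rw [h.integratedCDF_law, stepExpInt]
  rcases hx.eq_or_lt with hx | hx
  · rw [if_pos hx.ge, expLine_of_le h.h12 (by linarith [h.d_pos]), ← hx]
    ring
  · rw [if_neg hx.not_ge, if_pos hx3]

/-- The integrated CDF is below that of any law with mean `μ` that is above it on the middle
segment. -/
lemma integratedCDF_law_le {G : Measure ℝ} [IsProbabilityMeasure G] {a b x : ℝ}
    (hG : ∀ᵐ s ∂G, s ∈ Set.Icc a b) (hμ : ∫ s, s ∂G = μ)
    (hle : τ₁ - d ≤ x → x ≤ τ₃ → expLine g d τ₁ τ₂ x ≤ integratedCDF G x) :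
    integratedCDF h.law x ≤ integratedCDF G x := by
  rw [h.integratedCDF_law, stepExpInt]
  split_ifs with h1 h2
  · exact integratedCDF_nonneg x
  · exact hle (not_le.1 h1).le h2
  · rw [← hμ]
    exact sub_mean_le_integratedCDF hG x

/-- On the exponential region `d G = H` exactly. Beyond `τ₂` the function `H` is a line, so `H - d
G` grows from zero, and from `τ₃` on `H = x - μ ≥ d` because `μ + d ≤ τ₃`. -/
lemma isTopThreshold_law (hc : τ₂ ≤ μ + d) (hc3 : μ + d ≤ τ₃) : IsTopThreshold h.law d τ₁ := by
  have hd := h.d_pos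
  have h12 := h.h12
  have h23 := h.h23
  refine ⟨h.d_pos.le, ?_, fun x hx => ?_, fun _ => ?_⟩
  · rw [h.cdf_law, h.integratedCDF_law_of_mem (by linarith) (by linarith), expLine_of_le h12 le_rfl,
      stepExpFun, if_neg (by linarith)]
    -- If `τ₁ = τ₃` the CDF jumps to one at the threshold and the slope formula fails there; all
    -- three points then equal `μ + d`.
    rcases (h12.trans h23).eq_or_lt with he | hlt
    · have e2 : τ₂ = τ₁ := by linarith
      have := h.mean
      have e3 : μ + d = τ₁ := by linarith
      rw [← he, if_neg (lt_irrefl _)]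
      rw [← he, e2, sub_self, zero_div, Real.exp_zero] at this
      simp only [sub_self, add_zero, mul_one] at this ⊢
      linarith
    · rw [if_pos hlt, expSlope_of_le h12 le_rfl]
      ring
  · rw [h.cdf_law, h.integratedCDF_law, stepExpFun, stepExpInt,
      if_neg (show ¬ x < τ₁ - d by linarith), if_neg (show ¬ x ≤ τ₁ - d by linarith)]
    rcases lt_or_ge x τ₃ with h3 | h3
    · rw [if_pos h3, if_pos h3.le]
      rcases le_total x τ₂ with h2 | h2
      · rw [expSlope_of_mem hx.le h2, expLine_of_mem hx.le h2]
      · rw [expSlope_of_ge h12 h2, expLine_of_ge h12 h2, mul_comm]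
        exact mul_le_mul_of_nonneg_left (by linarith)
          (mul_nonneg h.g_pos.le (Real.exp_pos _).le)
    · rw [if_neg h3.not_gt]
      split_ifs with h3'
      · have e : x = τ₃ := le_antisymm h3' h3
        rw [e, expLine_of_ge h12 h23, h.mean]
        linarith
      · linarith
  · refine h.g_pos.trans_le ?_
    rw [h.cdf_law, stepExpFun, if_neg (by linarith)]
    split_ifs
    · rw [expSlope_of_le h12 le_rfl]
    · refine le_trans ?_ h.top_le
      exact le_mul_of_one_le_right h.g_pos.le
        (Real.one_le_exp (div_nonneg (by linarith) hd.le))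

/-- The fees that make a step-exponential-step distribution optimal. -/
lemma isStepExpStep_law (h12 : τ₁ < τ₂) :
    IsStepExpStep μ h.law
      ⟨(1 - g * Real.exp ((τ₂ - τ₁) / d)) * (τ₃ - (μ + d)), d⟩ := by
  have hd := h.d_pos
  have h23 := h.h23
  have e : τ₁ - (τ₁ - d) = d := by ring
  have hg1 : g ≤ 1 := by
    have := h.expSlope_le_one τ₁
    rwa [expSlope_of_le h.h12 le_rfl] at this
  refine ⟨g, τ₁ - d, τ₁, τ₂, τ₃, ⟨h.g_pos.le, hg1⟩, by linarith, h12, h23,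
    fun s hs => ?_, fun s hs => ?_, fun s hs => ?_, fun s hs => ?_, fun s hs => ?_, e.symm, rfl⟩
  · rw [h.cdf_law, stepExpFun, if_pos hs]
  · rw [h.cdf_law, stepExpFun, if_neg hs.1.not_gt, if_pos (by linarith [hs.2]),
      expSlope_of_le h.h12 hs.2.le]
  · rw [h.cdf_law, stepExpFun, if_neg (by linarith [hs.1]), if_pos (by linarith [hs.2]),
      expSlope_of_mem hs.1 hs.2.le, e]
  · rw [h.cdf_law, stepExpFun, if_neg (by linarith [hs.1]), if_pos hs.2,
      expSlope_of_ge h.h12 hs.1, e]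
  · rw [h.cdf_law, stepExpFun, if_neg (by linarith), if_neg hs.not_gt]

/-- A step-exponential-step structure that contracts the prior is feasible. -/
lemma isFeasible_law {F : Measure ℝ} [IsProbabilityMeasure F] {θl θh : ℝ}
    (hF : F.support ⊆ Set.Icc θl θh) (hμ : priorMean F = μ) (hl : θl ≤ τ₁ - d) (hh : τ₃ ≤ θh)
    (hle : ∀ x ∈ Set.Icc θl θh, τ₁ - d ≤ x → x ≤ τ₃ → expLine g d τ₁ τ₂ x ≤ integratedCDF F x)
    (hc : τ₂ ≤ μ + d) (hc3 : μ + d ≤ τ₃) :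
    IsFeasible θl θh F h.law
      ⟨(1 - g * Real.exp ((τ₂ - τ₁) / d)) * (τ₃ - (μ + d)), d⟩ τ₁ := by
  have := h.isProbabilityMeasure_law
  have hsub : h.law.support ⊆ Set.Icc θl θh :=
    h.support_law_subset.trans (Set.Icc_subset_Icc hl hh)
  have hd := h.d_pos
  have h12 := h.h12
  refine ⟨isMPC_of_integratedCDF_le hF hsub (by rw [h.mean_law, hμ]) fun x hx => ?_, ?_, ?_⟩
  · exact h.integratedCDF_law_le (ae_mem_of_support_subset hF) hμ (hle x hx)
  · rw [WeakParticipation, hμ]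
    simp only
    rw [setIntegral_Ioc_sub_eq (ae_mem_of_support_subset hsub), h.mean_law,
      h.integratedCDF_law_of_mem (by linarith) hc3, expLine_of_ge h12 hc]
    have := h.mean
    linarith
  · exact (h.isTopThreshold_law hc hc3).isWeakHighestThreshold hsub hd

/-- The testing fee makes participation bind, so this is `H(μ + d) - H(τ₁)`. -/
lemma thresholdRevenue_law (hτ : τ₁ < τ₃) (hc : τ₂ ≤ μ + d) :
    thresholdRevenue h.law ⟨(1 - g * Real.exp ((τ₂ - τ₁) / d)) * (τ₃ - (μ + d)), d⟩ τ₁ =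
      expLine g d τ₁ τ₂ (μ + d) - d * g := by
  have hd := h.d_pos
  rw [thresholdRevenue, h.cdf_law, stepExpFun, if_neg (by linarith), if_pos hτ,
    expSlope_of_le h.h12 le_rfl, expLine_of_ge h.h12 hc]
  have := h.mean
  linarith

end StepExpParams

/-! ### A distribution that beats revenue from testing fees alone -/

/-- Convexity again: the chord joins the values `0` at `a` and `b - E[s]` at `b`. -/
lemma integratedCDF_le_chord {G : Measure ℝ} [IsProbabilityMeasure G] {a b x : ℝ}
    (hG : ∀ᵐ s ∂G, s ∈ Set.Icc a b) (hx : x ∈ Set.Icc a b) :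
    (b - a) * integratedCDF G x ≤ (b - ∫ s, s ∂G) * (x - a) := by
  have hi := integrable_of_ae_mem_Icc hG
  have e : (b - ∫ s, s ∂G) * (x - a) = ∫ s, (b - s) * (x - a) ∂G := by
    rw [integral_mul_const, integral_sub (integrable_const b) hi]
    simp
  rw [e, integratedCDF, ← integral_const_mul]
  refine integral_mono_ae ((integrable_max_sub hG x).const_mul _)
    (((integrable_const b).sub hi).mul_const _) ?_
  filter_upwards [hG] with s hs
  rcases le_total s x with h | h
  · simp only [max_eq_left (sub_nonneg.2 h)]
    nlinarith [mul_nonneg (sub_nonneg.2 hx.2) (sub_nonneg.2 hs.1)]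
  · simp only [max_eq_right (sub_nonpos.2 h), mul_zero]
    exact mul_nonneg (sub_nonneg.2 hs.2) (sub_nonneg.2 hx.1)

/-- The exponential distribution on `[a, b]` with mean `μ` that has an atom at `a` only. -/
lemma stepExpParams_of_lt {a μ b : ℝ} (ha : a < μ) (hb : μ < b) :
    StepExpParams μ (Real.exp ((a - μ) / (b - μ))) (b - μ) (a + (b - μ)) b b := by
  have e : Real.exp ((a - μ) / (b - μ)) * Real.exp ((b - (a + (b - μ))) / (b - μ)) = 1 := by
    rw [← Real.exp_add, ← add_div, show a - μ + (b - (a + (b - μ))) = 0 by ring]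
    simp
  exact ⟨Real.exp_pos _, by linarith, by linarith, le_rfl, e.le, by rw [e]; ring⟩

section Example

variable {F : Measure ℝ} [IsProbabilityMeasure F] {θl θh : ℝ}

lemma integratedCDF_priorMean_pos (hθ : θl < θh) (hl : IsLeast F.support θl)
    (hh : IsGreatest F.support θh) : 0 < integratedCDF F (priorMean F) := by
  have hae := ae_mem_of_support_subset (support_subset_Icc hl hh)
  have hμ := lt_priorMean hθ hl hh
  rw [integratedCDF, integral_pos_iff_support_of_nonneg_ae
    (f := fun s => max (priorMean F - s) 0) (ae_of_all _ fun s => le_max_right _ _)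
    (integrable_max_sub hae _)]
  refine (Measure.mem_support_iff_forall θl |>.1 hl.1 _ (Iio_mem_nhds hμ)).trans_le
    (measure_mono fun s hs => ?_)
  exact (lt_max_of_lt_left (sub_pos.2 hs)).ne'

lemma cdf_priorMean_lt_one (hθ : θl < θh) (hl : IsLeast F.support θl)
    (hh : IsGreatest F.support θh) : cdf F (priorMean F) < 1 := by
  have hμ := priorMean_lt hθ hl hh
  have h1 := Measure.mem_support_iff_forall θh |>.1 hh.1 _ (Ioi_mem_nhds hμ)
  refine lt_of_le_of_ne (cdf_le_one _ _) fun he => ?_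
  rw [cdf_eq_real, measureReal_def, ENNReal.toReal_eq_one_iff,
    ← prob_compl_eq_zero_iff measurableSet_Iic, Set.compl_Iic] at he
  exact h1.ne' he

/-- Some step-exponential-step structure yields more than the best testing fee. -/
lemma exists_isFeasible_gt (hθ : θl < θh) (hl : IsLeast F.support θl)
    (hh : IsGreatest F.support θh) :
    ∃ (G : Measure ℝ) (φ : Fees) (τ : ℝ), IsFeasible θl θh F G φ τ ∧
      integratedCDF F (priorMean F) < thresholdRevenue G φ τ := by
  have hF := support_subset_Icc hl hh
  have hae := ae_mem_of_support_subset hF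
  set μ := priorMean F with hμdef
  set H := integratedCDF F μ
  set q := cdf F μ
  have hH : 0 < H := integratedCDF_priorMean_pos hθ hl hh
  have hq1 : q < 1 := cdf_priorMean_lt_one hθ hl hh
  have hμl := lt_priorMean hθ hl hh
  have htan : ∀ x, H + q * (x - μ) ≤ integratedCDF F x := integratedCDF_tangent hae μ
  have hlo := htan θl
  rw [integratedCDF_eq_zero hae le_rfl] at hlo
  have hhi := htan θh
  rw [integratedCDF_of_ge hae le_rfl, ← priorMean, ← hμdef] at hhi
  have hq0 : 0 < q := by
    refine lt_of_le_of_ne (cdf_nonneg _ _) fun h0 => ?_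
    rw [← h0] at hlo
    linarith
  have hq1' : 0 < 1 - q := by linarith
  -- `a` and `b` are where the tangent to the prior's integrated CDF at `μ` meets zero and the
  -- asymptote `x - μ`. The chord of any law on `[a, b]` with mean `μ` is this tangent, so every
  -- such law contracts the prior.
  set a := μ - H / q with ha
  set b := μ + H / (1 - q) with hb
  have haμ : a < μ := by have := div_pos hH hq0; linarith
  have hμb : μ < b := by have := div_pos hH hq1'; linarith
  have hqa : q * (μ - a) = H := by rw [ha]; field_simp; ring
  have hqb : (1 - q) * (b - μ) = H := by rw [hb]; field_simp; ring
  have hla : θl ≤ a := by nlinarith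
  have hbh : b ≤ θh := by nlinarith
  have h := stepExpParams_of_lt haμ hμb
  have := h.isProbabilityMeasure_law
  have hlaw : ∀ᵐ s ∂h.law, s ∈ Set.Icc a b := by
    have := h.ae_mem_law
    rwa [add_sub_cancel_right] at this
  refine ⟨h.law, _, _, h.isFeasible_law hF hμdef.symm (by linarith) hbh ?_ (by linarith)
    (by linarith), ?_⟩
  · intro x _ h1 h2
    rw [← h.integratedCDF_law_of_mem h1 h2]
    refine le_trans ?_ (htan x)
    have hchord := integratedCDF_le_chord hlaw (x := x) ⟨by linarith, h2⟩
    rw [h.mean_law] at hchord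
    have e1 : H + q * (x - μ) = q * (x - a) := by linarith
    have e2 : b - μ = q * (b - a) := by linarith
    rw [e1]
    have hba : 0 < b - a := by linarith
    have hchord' : (b - μ) * (x - a) = (b - a) * (q * (x - a)) := by
      rw [show (b - μ) * (x - a) = q * (b - a) * (x - a) by rw [← e2]]
      ring
    exact le_of_mul_le_mul_left (hchord.trans_eq hchord') hba
  · rw [h.thresholdRevenue_law (by linarith) (by linarith), expLine_of_ge (by linarith)
      (by linarith), ← Real.exp_add, ← add_div]
    have e : (a - μ + (b - (a + (b - μ)))) / (b - μ) = 0 := by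
      rw [show a - μ + (b - (a + (b - μ))) = 0 by ring, zero_div]
    rw [e, Real.exp_zero]
    -- Revenue is `b - μ` times one minus the bottom atom, while the best testing fee is `(b - μ) *
    -- (1 - q)`. The atom is `exp (-(1 - q) / q)`, below `q` by the strict form of `1 + x < exp x`.
    have hy : Real.exp ((a - μ) / (b - μ)) < q := by
      have hbμ : 0 < b - μ := by linarith
      have e1 : (a - μ) / (b - μ) = -((1 - q) / q) := by
        rw [div_eq_iff hbμ.ne', neg_mul, div_mul_eq_mul_div, hqb, ha]
        ring
      have h1 := Real.add_one_lt_exp (x := (1 - q) / q) (div_pos hq1' hq0).ne'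
      have e2 : (1 - q) / q + 1 = 1 / q := by field_simp; ring
      rw [e1, Real.exp_neg]
      rw [e2] at h1
      have := inv_strictAnti₀ (by positivity) h1
      simpa using this
    have hbμ : 0 < b - μ := by linarith
    nlinarith

end Example

/-! ### Existence of an optimal step-exponential-step structure -/

/-- The parameters of step-exponential-step structures whose distribution contracts `F`. -/
structure IsCandidate (F : Measure ℝ) (θl θh d g τ₁ τ₂ : ℝ) : Prop where
  g_nonneg : 0 ≤ g
  g_le : g ≤ 1
  low : θl + d ≤ τ₁
  h12 : τ₁ ≤ τ₂
  mid : τ₂ ≤ priorMean F + d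
  high : priorMean F + d ≤ θh
  top_le : g * Real.exp ((τ₂ - τ₁) / d) ≤ 1
  -- At `μ + d` the line is at or above the asymptote `x - μ`. This forces the meeting point `τ₃`,
  -- which is not a parameter here, to be at least `μ + d`.
  participation : d ≤ g * Real.exp ((τ₂ - τ₁) / d) * (d + (priorMean F + d - τ₂))
  below : ∀ x ∈ Set.Icc θl θh, expLine g d τ₁ τ₂ x ≤ integratedCDF F x

section Existence

variable {F : Measure ℝ} [IsProbabilityMeasure F] {θl θh : ℝ}

/-- Every structure that beats the best testing fee is dominated by a candidate. -/
lemma IsTopThreshold.exists_isCandidate (hF : F.support ⊆ Set.Icc θl θh) {G : Measure ℝ} {d τ : ℝ}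
    (hG : IsMPC θl θh F G) (h : IsTopThreshold G d τ) (hd : 0 < d)
    (hr : integratedCDF F (priorMean F) <
      integratedCDF G (priorMean F + d) - integratedCDF G τ) :
    ∃ g τ₂, IsCandidate F θl θh d g τ τ₂ ∧
      integratedCDF G (priorMean F + d) - integratedCDF G τ ≤
        expLine g d τ τ₂ (priorMean F + d) - d * g := by
  have := hG.prob
  have hae := hG.ae_mem
  have hmean := hG.mean_eq hF
  have hFae := ae_mem_of_support_subset hF
  set μ := priorMean F with hμ
  have hr0 : 0 < integratedCDF G (μ + d) - integratedCDF G τ :=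
    (integratedCDF_nonneg _).trans_lt hr
  have hτb := h.lt_top hae (by rwa [hmean])
  have hcb := h.disclosure_le hae hτb
  have hτc := lt_mean_add_of_revenue_pos (d := d) (τ := τ) hae (by rwa [hmean])
  have haτ := h.add_le hae hd
  rw [hmean] at hcb hτc
  have hμI : μ ∈ Set.Icc θl θh := ⟨by linarith, by linarith⟩
  set A := integratedCDF G (μ + d) with hA
  set p := cdf G (μ + d) with hp
  set B := integratedCDF G τ with hB
  have hB0 : 0 ≤ B := integratedCDF_nonneg _
  have htan : ∀ x, A + p * (x - (μ + d)) ≤ integratedCDF G x := integratedCDF_tangent hae (μ + d)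
  have hp0 : 0 < p := by
    refine lt_of_le_of_ne (cdf_nonneg _ _) fun h0 => ?_
    have := htan θl
    rw [← h0, integratedCDF_eq_zero hae le_rfl] at this
    linarith
  have hp1 : p ≤ 1 := cdf_le_one _ _
  have hpA : d * p ≤ A := h.le _ hτc
  -- The point where the tangent at `μ + d` has height `d` times its slope; there an exponential of
  -- rate `1 / d` fits smoothly.
  set τ₂ := μ + d + d - A / p with hτ₂
  have hpτ₂ : p * τ₂ = p * (μ + d + d) - A := by rw [hτ₂]; field_simp
  have hline : ∀ x, A + p * (x - (μ + d)) = p * (d + (x - τ₂)) := fun x => by linarith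
  -- If `τ₂ ≤ τ`, the tangent gives `H(τ) ≥ d * p`, and read at `μ` it gives `A - d * p ≤ H(μ)`;
  -- revenue would then not beat the best testing fee.
  have hlt : τ < τ₂ := by
    by_contra hle
    have h1 := htan τ
    have h2 := htan μ
    have h3 := hG.integratedCDF_le hF hμI
    have : d * p ≤ A + p * (τ - (μ + d)) := by rw [hline]; nlinarith
    rw [← hB] at h1
    linarith
  have hc2 : τ₂ ≤ μ + d := by nlinarith
  have hA' : A = p * (d + (μ + d - τ₂)) := by rw [← hline]; ring
  -- Chosen so that the exponential started at `τ` reaches the tangent's slope `p` at `τ₂`.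
  set g := p * Real.exp (-((τ₂ - τ) / d)) with hg
  have hgp : g * Real.exp ((τ₂ - τ) / d) = p := by
    rw [hg, mul_assoc, ← Real.exp_add]; simp
  have hg0 : 0 < g := mul_pos hp0 (Real.exp_pos _)
  have hgple : g ≤ p := by
    rw [hg]
    refine mul_le_of_le_one_right hp0.le (Real.exp_le_one_iff.2 (neg_nonpos.2 ?_))
    exact div_nonneg (by linarith) hd.le
  -- the exponential piece lies below the integrated CDF
  have hexp : ∀ x, τ ≤ x → x ≤ τ₂ →
      d * (g * Real.exp ((x - τ) / d)) ≤ integratedCDF G x := by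
    intro x h1 h2
    refine le_trans ?_ (integratedCDF_growth hae hd h.le h1 h2)
    have h3 := htan τ₂
    rw [hline, sub_self, add_zero] at h3
    have e : d * (g * Real.exp ((x - τ) / d)) = p * d * Real.exp (-((τ₂ - x) / d)) := by
      rw [hg, mul_assoc p, ← Real.exp_add]
      have : -((τ₂ - τ) / d) + (x - τ) / d = -((τ₂ - x) / d) := by ring
      rw [this]
      ring
    rw [e]
    exact mul_le_mul_of_nonneg_right h3 (Real.exp_pos _).le
  have hgB : d * g ≤ B := by
    have := hexp τ le_rfl hlt.le
    simpa using this
  refine ⟨g, τ₂, ⟨hg0.le, hgple.trans hp1, haτ, hlt.le, hc2, hcb, hgp.trans_le hp1, ?_, ?_⟩, ?_⟩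
  · rw [hgp, ← hA']
    have := sub_mean_le_integratedCDF hae (μ + d)
    rw [hmean] at this
    linarith
  · intro x hx
    refine le_trans ?_ (hG.integratedCDF_le hF hx)
    rcases le_total x τ with h1 | h1
    · rw [expLine_of_le hlt.le h1]
      rcases le_total (d + (x - τ)) 0 with h2 | h2
      · exact (mul_nonpos_of_nonneg_of_nonpos hg0.le h2).trans (integratedCDF_nonneg _)
      -- Both lines vanish at `τ - d`, and the tangent at `τ` is the steeper one.
      · have h3 := integratedCDF_tangent hae τ x
        rw [← h.eq] at h3
        have h4 : g ≤ cdf G τ := by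
          have := h.eq
          rw [← hB] at this
          nlinarith
        nlinarith
    · rcases le_total x τ₂ with h2 | h2
      · rw [expLine_of_mem h1 h2]
        exact hexp x h1 h2
      · rw [expLine_of_ge hlt.le h2, hgp, ← hline]
        exact htan x
  · rw [expLine_of_ge hlt.le hc2, hgp, ← hA']
    linarith

/-- Candidates that beat the best testing fee come from feasible step-exponential-step
structures. -/
lemma IsCandidate.exists_isFeasible (hF : F.support ⊆ Set.Icc θl θh) {d g τ₁ τ₂ : ℝ}
    (h : IsCandidate F θl θh d g τ₁ τ₂) (hd : 0 < d)
    (hr : integratedCDF F (priorMean F) < expLine g d τ₁ τ₂ (priorMean F + d) - d * g) :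
    ∃ (G : Measure ℝ) (φ : Fees), IsStepExpStep (priorMean F) G φ ∧ IsFeasible θl θh F G φ τ₁ ∧
      thresholdRevenue G φ τ₁ = expLine g d τ₁ τ₂ (priorMean F + d) - d * g := by
  obtain ⟨hg0, hg1, hlow, h12, hmid, hhigh, htop, hpart, hbelow⟩ := h
  have hFae := ae_mem_of_support_subset hF
  set μ := priorMean F with hμ
  have hμI : μ ∈ Set.Icc θl θh := ⟨by linarith, by linarith⟩
  set p := g * Real.exp ((τ₂ - τ₁) / d) with hp
  have hgpos : 0 < g := by
    refine lt_of_le_of_ne hg0 fun h0 => ?_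
    rw [hp, ← h0] at hpart
    linarith
  -- Without an exponential region the revenue is `g * (μ + d - τ₂)`, the height of the line at `μ`,
  -- which `hbelow` bounds by the best testing fee.
  have hlt : τ₁ < τ₂ := by
    refine lt_of_le_of_ne h12 fun he => ?_
    have h1 := hbelow μ hμI
    have hpg : p = g := by rw [hp, he]; simp
    rw [expLine_of_ge h12 hmid, ← hp, hpg] at hr
    rcases le_total μ τ₁ with h2 | h2
    · rw [expLine_of_le h12 h2, he] at h1
      linarith
    · rw [expLine_of_ge h12 (he ▸ h2), ← hp, hpg] at h1
      linarith
  have htopline : p * (d + (θh - τ₂)) ≤ θh - μ := by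
    have := hbelow θh ⟨by linarith [hμI.1], le_rfl⟩
    rwa [expLine_of_ge h12 (hmid.trans hhigh), integratedCDF_of_ge hFae le_rfl, ← priorMean,
      ← hμ, ← hp] at this
  -- `τ₃` is where the line meets `x - μ`: participation places it above `μ + d`, and the bound at
  -- `θh` below `θh`. With slope one the two lines coincide and `μ + d` serves.
  obtain ⟨τ₃, hc3, h3h, h3⟩ : ∃ τ₃, μ + d ≤ τ₃ ∧ τ₃ ≤ θh ∧ p * (d + (τ₃ - τ₂)) = τ₃ - μ := by
    rcases htop.eq_or_lt with h1 | h1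
    · rw [h1] at htopline hpart ⊢
      exact ⟨μ + d, le_rfl, hhigh, by linarith⟩
    · have h1' : 0 < 1 - p := by linarith
      refine ⟨(μ + p * (d - τ₂)) / (1 - p), ?_, ?_, ?_⟩
      · rw [le_div_iff₀ h1']
        linarith
      · rw [div_le_iff₀ h1']
        linarith
      · field_simp
        ring
  have hpar : StepExpParams μ g d τ₁ τ₂ τ₃ :=
    ⟨hgpos, hd, h12, hmid.trans hc3, htop, h3⟩
  exact ⟨hpar.law, _, hpar.isStepExpStep_law hlt,
    hpar.isFeasible_law hF hμ.symm (by linarith) h3h (fun x hx _ _ => hbelow x hx) hmid hc3,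
    hpar.thresholdRevenue_law (by linarith) hmid⟩

lemma isCompact_isCandidate {F : Measure ℝ} {ε : ℝ} (hε : 0 < ε) :
    IsCompact {q : ℝ × ℝ × ℝ × ℝ | ε ≤ q.1 ∧ IsCandidate F θl θh q.1 q.2.1 q.2.2.1 q.2.2.2} := by
  -- Dividing by `max q.1 ε` makes the formulas continuous on the whole space without changing them
  -- where `ε ≤ q.1`.
  have hD : ∀ q : ℝ × ℝ × ℝ × ℝ, max q.1 ε ≠ 0 := fun q => (lt_max_of_lt_right hε).ne'
  have hexp : Continuous fun q : ℝ × ℝ × ℝ × ℝ =>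
      q.2.1 * Real.exp ((q.2.2.2 - q.2.2.1) / max q.1 ε) := by
    fun_prop (disch := exact hD)
  have hline : ∀ x, Continuous fun q : ℝ × ℝ × ℝ × ℝ =>
      expLine q.2.1 (max q.1 ε) q.2.2.1 q.2.2.2 x := by
    intro x
    unfold expLine expSlope clampTo
    fun_prop (disch := exact hD)
  have hclosed : IsClosed {q : ℝ × ℝ × ℝ × ℝ | ε ≤ q.1 ∧ 0 ≤ q.2.1 ∧ q.2.1 ≤ 1 ∧
      θl + q.1 ≤ q.2.2.1 ∧ q.2.2.1 ≤ q.2.2.2 ∧ q.2.2.2 ≤ priorMean F + q.1 ∧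
      priorMean F + q.1 ≤ θh ∧
      q.2.1 * Real.exp ((q.2.2.2 - q.2.2.1) / max q.1 ε) ≤ 1 ∧
      q.1 ≤ q.2.1 * Real.exp ((q.2.2.2 - q.2.2.1) / max q.1 ε) *
        (q.1 + (priorMean F + q.1 - q.2.2.2)) ∧
      ∀ x ∈ Set.Icc θl θh,
        expLine q.2.1 (max q.1 ε) q.2.2.1 q.2.2.2 x ≤ integratedCDF F x} := by
    refine (isClosed_le (f := fun q : ℝ × ℝ × ℝ × ℝ => ε)
      (g := fun q => q.1) (by fun_prop) (by fun_prop)).inter ?_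
    refine (isClosed_le (f := fun q : ℝ × ℝ × ℝ × ℝ => 0)
      (g := fun q => q.2.1) (by fun_prop) (by fun_prop)).inter ?_
    refine (isClosed_le (f := fun q : ℝ × ℝ × ℝ × ℝ => q.2.1)
      (g := fun q => 1) (by fun_prop) (by fun_prop)).inter ?_
    refine (isClosed_le (f := fun q : ℝ × ℝ × ℝ × ℝ => θl + q.1)
      (g := fun q => q.2.2.1) (by fun_prop) (by fun_prop)).inter ?_
    refine (isClosed_le (f := fun q : ℝ × ℝ × ℝ × ℝ => q.2.2.1)
      (g := fun q => q.2.2.2) (by fun_prop) (by fun_prop)).inter ?_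
    refine (isClosed_le (f := fun q : ℝ × ℝ × ℝ × ℝ => q.2.2.2)
      (g := fun q => priorMean F + q.1) (by fun_prop) (by fun_prop)).inter ?_
    refine (isClosed_le (f := fun q : ℝ × ℝ × ℝ × ℝ => priorMean F + q.1)
      (g := fun q => θh) (by fun_prop) (by fun_prop)).inter ?_
    refine (isClosed_le hexp continuous_const).inter ?_
    refine (isClosed_le continuous_fst (hexp.mul
      (g := fun q => q.1 + (priorMean F + q.1 - q.2.2.2)) (by fun_prop))).inter ?_
    have hbelow : IsClosed {q : ℝ × ℝ × ℝ × ℝ | ∀ x ∈ Set.Icc θl θh,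
        expLine q.2.1 (max q.1 ε) q.2.2.1 q.2.2.2 x ≤ integratedCDF F x} := by
      simp only [Set.ofPred_forall]
      exact isClosed_iInter fun x => isClosed_iInter fun _ => isClosed_le (hline x) continuous_const
    exact hbelow
  refine IsCompact.of_isClosed_subset
    (isCompact_Icc (a := ((ε, 0, θl, θl) : ℝ × ℝ × ℝ × ℝ))
      (b := (θh - priorMean F, 1, θh, θh))) ?_ ?_
  · convert hclosed using 1
    ext q
    constructor
    · rintro ⟨h0, h⟩
      have e : max q.1 ε = q.1 := max_eq_left h0
      refine ⟨h0, h.g_nonneg, h.g_le, h.low, h.h12, h.mid, h.high, ?_, ?_, ?_⟩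
      · rw [e]; exact h.top_le
      · rw [e]; exact h.participation
      · rw [e]; exact h.below
    · rintro ⟨h0, h1, h2, h3, h4, h5, h6, h7, h8, h9⟩
      have e : max q.1 ε = q.1 := max_eq_left h0
      rw [e] at h7 h8 h9
      exact ⟨h0, h1, h2, h3, h4, h5, h6, h7, h8, h9⟩
  · rintro ⟨d, g, τ₁, τ₂⟩ ⟨h0, h⟩
    have h1 := h.low
    have h2 := h.h12
    have h3 := h.mid
    have h4 := h.high
    simp only at h0 h1 h2 h3 h4
    exact ⟨⟨h0, h.g_nonneg, by simp only; linarith, by simp only; linarith⟩,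
      ⟨by simp only; linarith, h.g_le, by simp only; linarith, by simp only; linarith⟩⟩

/-- Feasible structures with a nonpositive disclosure fee yield at most the best testing fee. -/
lemma IsFeasible.revenue_le_of_disclosure_nonpos (hF : F.support ⊆ Set.Icc θl θh)
    (hθ : priorMean F ∈ Set.Icc θl θh)
    {G : Measure ℝ} {φ : Fees} {τ : ℝ} (h : IsFeasible θl θh F G φ τ) (hd : φ.disclosure ≤ 0) :
    thresholdRevenue G φ τ ≤ integratedCDF F (priorMean F) := by
  obtain ⟨hG, hp, ht⟩ := h
  have := hG.prob
  have h0 := (ht.isTopThreshold hG.support_subset).nonneg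
  have hd0 : φ.disclosure = 0 := le_antisymm hd h0
  rw [WeakParticipation, setIntegral_Ioc_sub_eq hG.ae_mem, hG.mean_eq hF, hd0, add_zero] at hp
  rw [thresholdRevenue, hd0]
  have := hG.integratedCDF_le hF hθ
  linarith

lemma IsFeasible.revenue_le (hF : F.support ⊆ Set.Icc θl θh)
    {G : Measure ℝ} {φ : Fees} {τ : ℝ} (h : IsFeasible θl θh F G φ τ) :
    thresholdRevenue G φ τ ≤
      integratedCDF G (priorMean F + φ.disclosure) - integratedCDF G τ := by
  obtain ⟨hG, hp, ht⟩ := h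
  have := hG.prob
  have hm := hG.mean_eq hF
  have hr := (ht.isTopThreshold hG.support_subset).revenue_le (t := φ.testing) (by
    rw [WeakParticipation, setIntegral_Ioc_sub_eq hG.ae_mem, hm] at hp
    rw [hm]
    linarith)
  rwa [hm] at hr

/-- A maximizer of `J` over the compact set of candidates is optimal: structures worth at least the
example are dominated by candidates, the rest by the example. The example's strict gain `ε` keeps
disclosure fees away from zero, where compactness would fail. -/
theorem exists_isStepExpStep_isRobustlyOptimal (hθ : θl < θh) (hl : IsLeast F.support θl)
    (hh : IsGreatest F.support θh) :
    ∃ (G : Measure ℝ) (φ : Fees),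
      IsStepExpStep (priorMean F) G φ ∧ IsRobustlyOptimal θl θh F G φ := by
  have hF := support_subset_Icc hl hh
  have hFae := ae_mem_of_support_subset hF
  have hμI : priorMean F ∈ Set.Icc θl θh :=
    ⟨(lt_priorMean hθ hl hh).le, (priorMean_lt hθ hl hh).le⟩
  obtain ⟨G₀, φ₀, τ₀, hf₀, hr₀⟩ := exists_isFeasible_gt hθ hl hh
  set r := thresholdRevenue G₀ φ₀ τ₀
  set ε := r - integratedCDF F (priorMean F) with hεdef
  have hε : 0 < ε := sub_pos.2 hr₀
  set C := {q : ℝ × ℝ × ℝ × ℝ | ε ≤ q.1 ∧ IsCandidate F θl θh q.1 q.2.1 q.2.2.1 q.2.2.2}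
  set J : ℝ × ℝ × ℝ × ℝ → ℝ := fun q =>
    expLine q.2.1 q.1 q.2.2.1 q.2.2.2 (priorMean F + q.1) - q.1 * q.2.1
  -- every structure at least as good as the example is dominated by a candidate
  have hdom : ∀ G φ τ, IsFeasible θl θh F G φ τ → r ≤ thresholdRevenue G φ τ →
      ∃ q ∈ C, thresholdRevenue G φ τ ≤ J q := by
    intro G φ τ hf hr
    have := hf.1.prob
    have hd : 0 < φ.disclosure := by
      by_contra hd
      have := hf.revenue_le_of_disclosure_nonpos hF hμI (not_lt.1 hd)
      linarith
    have hrev := hf.revenue_le hF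
    obtain ⟨g, τ₂, hc, hJ⟩ := (hf.2.2.isTopThreshold hf.1.support_subset).exists_isCandidate hF
      hf.1 hd (by linarith)
    refine ⟨(φ.disclosure, g, τ, τ₂), ⟨?_, hc⟩, hrev.trans hJ⟩
    -- `H` is 1-Lipschitz, so revenue exceeds the best testing fee by at most `d`; hence `d ≥ ε`.
    have h1 := integratedCDF_sub_le hf.1.ae_mem
      (show priorMean F ≤ priorMean F + φ.disclosure by linarith)
    have h2 := hf.1.integratedCDF_le hF hμI
    have h3 := integratedCDF_nonneg (G := G) τ
    simp only
    linarith
  obtain ⟨q₀, hq₀, hJ₀⟩ := hdom _ _ _ hf₀ le_rfl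
  have hJ : ContinuousOn J C := by
    have hcont : Continuous fun q : ℝ × ℝ × ℝ × ℝ =>
        expLine q.2.1 (max q.1 ε) q.2.2.1 q.2.2.2 (priorMean F + q.1) - q.1 * q.2.1 := by
      have hD : ∀ q : ℝ × ℝ × ℝ × ℝ, max q.1 ε ≠ 0 := fun q => (lt_max_of_lt_right hε).ne'
      unfold expLine expSlope clampTo
      fun_prop (disch := exact hD)
    refine hcont.continuousOn.congr fun q hq => ?_
    simp only [J, max_eq_left hq.1]
  obtain ⟨⟨d, g, τ₁, τ₂⟩, ⟨hdε, hcand⟩, hmax⟩ :=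
    (isCompact_isCandidate hε).exists_isMaxOn ⟨q₀, hq₀⟩ hJ
  have hr : r ≤ J (d, g, τ₁, τ₂) := hJ₀.trans (hmax hq₀)
  obtain ⟨G, φ, hses, hf, hrev⟩ := hcand.exists_isFeasible hF (hε.trans_le hdε)
    (show _ < J (d, g, τ₁, τ₂) by linarith)
  refine ⟨G, φ, hses, τ₁, hf, fun G' φ' τ' hf' => ?_⟩
  rw [hrev]
  rcases le_total r (thresholdRevenue G' φ' τ') with h1 | h1
  · obtain ⟨q, hq, hJq⟩ := hdom _ _ _ hf' h1
    exact hJq.trans (hmax hq)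
  · exact h1.trans hr

theorem IsRobustlyOptimal.disclosure_pos (hθ : θl < θh) (hl : IsLeast F.support θl)
    (hh : IsGreatest F.support θh) {G : Measure ℝ} {φ : Fees}
    (h : IsRobustlyOptimal θl θh F G φ) : 0 < φ.disclosure := by
  obtain ⟨τ, hf, hmax⟩ := h
  obtain ⟨G₀, φ₀, τ₀, hf₀, hr₀⟩ := exists_isFeasible_gt hθ hl hh
  by_contra hd
  have h1 := hf.revenue_le_of_disclosure_nonpos (support_subset_Icc hl hh)
    ⟨(lt_priorMean hθ hl hh).le, (priorMean_lt hθ hl hh).le⟩ (not_lt.1 hd)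
  have h2 := hmax _ _ _ hf₀
  linarith

/-- The testing fee enters no threshold condition, so at an optimum it is raised until participation
binds. -/
theorem IsRobustlyOptimal.testing_pos_iff {F G : Measure ℝ} {φ : Fees}
    (h : IsRobustlyOptimal θl θh F G φ) :
    0 < φ.testing ↔ 0 < G (Set.Ioc (priorMean F + φ.disclosure) θh) := by
  obtain ⟨τ, ⟨hG, hp, ht⟩, hmax⟩ := h
  have := hG.prob
  have heq : φ.testing = ∫ s in Set.Ioc (priorMean F + φ.disclosure) θh,
      (s - (priorMean F + φ.disclosure)) ∂G := by
    refine le_antisymm hp ?_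
    have := hmax G ⟨∫ s in Set.Ioc (priorMean F + φ.disclosure) θh,
      (s - (priorMean F + φ.disclosure)) ∂G, φ.disclosure⟩ τ ⟨hG, le_rfl, ht⟩
    simp only [thresholdRevenue] at this
    linarith
  rw [heq, setIntegral_Ioc_sub_pos_iff hG.ae_mem]

end Existence

/-! ### First-price competition -/

lemma buyerPayoff_eq {ρ : Measure ℝ} [IsProbabilityMeasure ρ] (hi : Integrable (fun θ : ℝ => θ) ρ)
    (b b' : ℝ) :
    buyerPayoff ρ b b' = if b' < b then (∫ θ, θ ∂ρ) - b
      else if b = b' then ((∫ θ, θ ∂ρ) - b) / 2 else 0 := by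
  have : ∫ θ, (θ - b) ∂ρ = (∫ θ, θ ∂ρ) - b := by
    rw [integral_sub hi (integrable_const b)]
    simp
  rw [buyerPayoff, this]

lemma buyerPayoff_le_of_eq_mean {ρ : Measure ℝ} [IsProbabilityMeasure ρ]
    (hi : Integrable (fun θ : ℝ => θ) ρ) (b : ℝ) :
    buyerPayoff ρ b (∫ θ, θ ∂ρ) ≤ buyerPayoff ρ (∫ θ, θ ∂ρ) (∫ θ, θ ∂ρ) := by
  rw [buyerPayoff_eq hi, buyerPayoff_eq hi]
  simp only [lt_self_iff_false, if_false, if_true, sub_self, zero_div]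
  split_ifs with h1 h2 <;> linarith

/-- In every equilibrium of the first-price auction both bidders bid the common value. -/
lemma bids_eq_mean {ρ : Measure ℝ} [IsProbabilityMeasure ρ] (hi : Integrable (fun θ : ℝ => θ) ρ)
    {b₀ b₁ : ℝ} (h : ∀ b, buyerPayoff ρ b b₁ ≤ buyerPayoff ρ b₀ b₁ ∧
      buyerPayoff ρ b b₀ ≤ buyerPayoff ρ b₁ b₀) :
    max b₀ b₁ = ∫ θ, θ ∂ρ := by
  simp only [buyerPayoff_eq hi] at h
  set v := ∫ θ, θ ∂ρ
  rcases lt_trichotomy b₀ b₁ with hlt | heq | hlt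
  · exfalso
    -- The strict winner gains by shading towards the losing bid, whatever the value.
    have h1 := (h ((b₀ + b₁) / 2)).2
    rw [if_pos (by linarith), if_pos hlt] at h1
    linarith
  · subst heq
    simp only [lt_self_iff_false, if_false, if_true, and_self] at h
    rw [max_self]
    refine le_antisymm ?_ ?_
    · have := h (b₀ - 1)
      rw [if_neg (by linarith), if_neg (by linarith)] at this
      linarith
    · by_contra hlt
      have hlt := not_le.1 hlt
      -- Winning for sure at this bid keeps three quarters of the margin; the tie yields half.
      have := h (b₀ + (v - b₀) / 4)
      rw [if_pos (by linarith)] at this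
      linarith
  · exfalso
    have h1 := (h ((b₀ + b₁) / 2)).1
    rw [if_pos (by linarith), if_pos hlt] at h1
    linarith

/-! ### Unbiased tests -/

section Posterior

variable {F : Measure ℝ} [IsProbabilityMeasure F] {κ : Kernel ℝ ℝ} [IsMarkovKernel κ] {θl θh : ℝ}

lemma ae_fst_compProd {S : Set ℝ} (hF : ∀ᵐ θ ∂F, θ ∈ S) : ∀ᵐ p ∂(F ⊗ₘ κ), p.1 ∈ S := by
  have h : (F ⊗ₘ κ).fst = F := Measure.fst_compProd F κ
  rw [← h] at hF
  exact ae_of_ae_map measurable_fst.aemeasurable hF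

lemma compProd_eq_map_swap_posterior :
    F ⊗ₘ κ = ((κ ∘ₘ F) ⊗ₘ posterior κ F).map Prod.swap := by
  rw [compProd_posterior_eq_map_swap, Measure.map_map measurable_swap
    measurable_swap, Prod.swap_swap_eq, Measure.map_id]

lemma ae_ae_posterior {S : Set ℝ} (hF : ∀ᵐ θ ∂F, θ ∈ S) :
    ∀ᵐ s ∂(κ ∘ₘ F), ∀ᵐ θ ∂(posterior κ F s), θ ∈ S := by
  have h := ae_fst_compProd (κ := κ) hF
  rw [compProd_eq_map_swap_posterior] at h
  exact Measure.ae_ae_of_ae_compProd (ae_of_ae_map measurable_swap.aemeasurable h)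

lemma integrable_mul_fst_compProd (hF : ∀ᵐ θ ∂F, θ ∈ Set.Icc θl θh) {f : ℝ → ℝ}
    (hf : Measurable f) (hf1 : ∀ s, f s ∈ Set.Icc (0 : ℝ) 1) :
    Integrable (fun p : ℝ × ℝ => f p.2 * p.1) (F ⊗ₘ κ) := by
  refine Integrable.of_bound (C := max |θl| |θh|) (by fun_prop) ?_
  filter_upwards [ae_fst_compProd hF] with p hp
  rw [norm_mul, Real.norm_eq_abs, Real.norm_eq_abs, abs_of_nonneg (hf1 _).1]
  exact (mul_le_of_le_one_left (abs_nonneg _) (hf1 _).2).trans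
    (abs_le_max_abs_abs hp.1 hp.2)

/-- Conditioning on the second coordinate. -/
lemma integral_mul_posterior_mean (hF : ∀ᵐ θ ∂F, θ ∈ Set.Icc θl θh) {f : ℝ → ℝ}
    (hf : Measurable f) (hf1 : ∀ s, f s ∈ Set.Icc (0 : ℝ) 1) :
    ∫ p, f p.2 * p.1 ∂(F ⊗ₘ κ) = ∫ s, f s * ∫ θ, θ ∂(posterior κ F s) ∂(κ ∘ₘ F) := by
  have hi := integrable_mul_fst_compProd (κ := κ) hF hf hf1
  rw [compProd_eq_map_swap_posterior] at hi ⊢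
  rw [integrable_map_measure hi.aestronglyMeasurable measurable_swap.aemeasurable] at hi
  rw [integral_map measurable_swap.aemeasurable (by fun_prop)]
  refine (Measure.integral_compProd hi).trans (integral_congr_ae (ae_of_all _ fun s => ?_))
  simp only [Function.comp_apply, Prod.swap]
  rw [integral_const_mul]

end Posterior

/-! ### Score laws and the null message. -/

section Test

variable {F : Measure ℝ} [IsProbabilityMeasure F] {θl θh : ℝ} (T : UnbiasedTest F)

instance UnbiasedTest.isProbabilityMeasure_scoreLaw : IsProbabilityMeasure T.scoreLaw := by
  unfold UnbiasedTest.scoreLaw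
  infer_instance

lemma UnbiasedTest.snd_compProd : (F ⊗ₘ T.kernel).snd = T.scoreLaw :=
  Measure.snd_compProd F T.kernel

variable {T}

lemma UnbiasedTest.ae_posterior {S : Set ℝ} (hF : ∀ᵐ θ ∂F, θ ∈ S) :
    ∀ᵐ s ∂T.scoreLaw, ∀ᵐ θ ∂(posterior T.kernel F s), θ ∈ S :=
  ae_ae_posterior hF

/-- Conditioning on the score. -/
lemma UnbiasedTest.integral_mul_eq (hF : ∀ᵐ θ ∂F, θ ∈ Set.Icc θl θh) {f : ℝ → ℝ}
    (hf : Measurable f) (hf1 : ∀ s, f s ∈ Set.Icc (0 : ℝ) 1) :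
    ∫ p, f p.2 * p.1 ∂(F ⊗ₘ T.kernel) = ∫ s, f s * s ∂T.scoreLaw := by
  rw [integral_mul_posterior_mean hF hf hf1]
  refine integral_congr_ae ?_
  filter_upwards [T.unbiased] with s hs
  rw [hs]

lemma UnbiasedTest.ae_mem_Icc (hF : ∀ᵐ θ ∂F, θ ∈ Set.Icc θl θh) :
    ∀ᵐ s ∂T.scoreLaw, s ∈ Set.Icc θl θh := by
  filter_upwards [T.unbiased, T.ae_posterior hF] with s hs hp
  have hi := integrable_of_ae_mem_Icc hp
  rw [← hs]
  constructor
  · have := integral_mono_ae (integrable_const θl) hi (hp.mono fun θ hθ => hθ.1)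
    simpa using this
  · have := integral_mono_ae hi (integrable_const θh) (hp.mono fun θ hθ => hθ.2)
    simpa using this

lemma UnbiasedTest.scores_subset (hF : ∀ᵐ θ ∂F, θ ∈ Set.Icc θl θh) :
    T.scores ⊆ Set.Icc θl θh :=
  Measure.support_subset_of_isClosed isClosed_Icc (T.ae_mem_Icc hF)

lemma UnbiasedTest.ae_mem_scores : ∀ᵐ s ∂T.scoreLaw, s ∈ T.scores :=
  T.scoreLaw.support_mem_ae

lemma UnbiasedTest.mean_scoreLaw (hF : ∀ᵐ θ ∂F, θ ∈ Set.Icc θl θh) :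
    ∫ s, s ∂T.scoreLaw = priorMean F := by
  have h := T.integral_mul_eq hF (f := fun _ => 1) measurable_const (by simp)
  simp only [one_mul] at h
  rw [← h, priorMean]
  have h1 : (F ⊗ₘ T.kernel).fst = F := Measure.fst_compProd F T.kernel
  conv_rhs => rw [← h1, Measure.fst]
  rw [integral_map measurable_fst.aemeasurable (by fun_prop)]

lemma Assessment.ae_nullLaw {S : Set ℝ} (a : Assessment) (hF : ∀ᵐ θ ∂F, θ ∈ S) :
    ∀ᵐ θ ∂(a.nullLaw T), θ ∈ S := by
  rw [Assessment.nullLaw, ae_add_measure_iff]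
  refine ⟨Measure.ae_smul_measure hF _, Measure.ae_smul_measure ?_ _⟩
  have hac : ((F ⊗ₘ T.kernel).withDensity
      (fun p => ENNReal.ofReal (1 - a.discloseProb p.2))).fst ≪ (F ⊗ₘ T.kernel).fst :=
    (withDensity_absolutelyContinuous _ _).map measurable_fst
  rw [Measure.fst_compProd] at hac
  exact hac.ae_le hF

lemma integrable_of_mem_Icc_zero_one {G : Measure ℝ} [IsFiniteMeasure G] {f : ℝ → ℝ}
    (hf : Measurable f) (hf1 : ∀ s, f s ∈ Set.Icc (0 : ℝ) 1) : Integrable f G := by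
  refine Integrable.of_bound (C := 1) (by fun_prop) (ae_of_all _ fun s => ?_)
  rw [Real.norm_eq_abs, abs_of_nonneg (hf1 s).1]
  exact (hf1 s).2

lemma Assessment.lintegral_conceal {a : Assessment}
    (hm : Measurable a.discloseProb) (hd : ∀ s, a.discloseProb s ∈ Set.Icc (0 : ℝ) 1) :
    ∫⁻ p, ENNReal.ofReal (1 - a.discloseProb p.2) ∂(F ⊗ₘ T.kernel) =
      ENNReal.ofReal (1 - ∫ s, a.discloseProb s ∂T.scoreLaw) := by
  have hmeas : Measurable fun s => ENNReal.ofReal (1 - a.discloseProb s) := by fun_prop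
  have hi := integrable_of_mem_Icc_zero_one (G := T.scoreLaw) hm hd
  have h1 : ∫⁻ p, ENNReal.ofReal (1 - a.discloseProb p.2) ∂(F ⊗ₘ T.kernel) =
      ∫⁻ s, ENNReal.ofReal (1 - a.discloseProb s) ∂T.scoreLaw := by
    rw [← T.snd_compProd, Measure.snd, lintegral_map hmeas measurable_snd]
  rw [h1, ← ofReal_integral_eq_lintegral_ofReal (f := fun s => 1 - a.discloseProb s)
      ((integrable_const 1).sub hi)
    (ae_of_all _ fun s => sub_nonneg.2 (hd s).2), integral_sub (integrable_const 1) hi]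
  simp

lemma Assessment.nullLaw_univ {a : Assessment} (ht : a.testProb ∈ Set.Icc (0 : ℝ) 1)
    (hm : Measurable a.discloseProb) (hd : ∀ s, a.discloseProb s ∈ Set.Icc (0 : ℝ) 1) :
    a.nullLaw T Set.univ = ENNReal.ofReal
      ((1 - a.testProb) + a.testProb * (1 - ∫ s, a.discloseProb s ∂T.scoreLaw)) := by
  have hle : ∫ s, a.discloseProb s ∂T.scoreLaw ≤ 1 := by
    have := integral_mono (integrable_of_mem_Icc_zero_one (G := T.scoreLaw) hm hd)
      (integrable_const 1) fun s => (hd s).2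
    simpa using this
  rw [Assessment.nullLaw]
  simp only [Measure.coe_add, Measure.coe_smul, Pi.add_apply, Pi.smul_apply, smul_eq_mul,
    measure_univ, mul_one, Measure.fst_univ, withDensity_apply _ MeasurableSet.univ,
    Measure.restrict_univ]
  rw [Assessment.lintegral_conceal hm hd, ← ENNReal.ofReal_mul ht.1,
    ← ENNReal.ofReal_add (sub_nonneg.2 ht.2) (mul_nonneg ht.1 (sub_nonneg.2 hle))]

/-- By unbiasedness a concealed score contributes its own value, so the null price depends on the
test only through the score law. -/
lemma Assessment.integral_nullLaw (hF : ∀ᵐ θ ∂F, θ ∈ Set.Icc θl θh) {a : Assessment}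
    (ht : a.testProb ∈ Set.Icc (0 : ℝ) 1)
    (hm : Measurable a.discloseProb) (hd : ∀ s, a.discloseProb s ∈ Set.Icc (0 : ℝ) 1) :
    ∫ θ, θ ∂(a.nullLaw T) = (1 - a.testProb) * priorMean F +
      a.testProb * ∫ s, (1 - a.discloseProb s) * s ∂T.scoreLaw := by
  have hd' : ∀ s, 1 - a.discloseProb s ∈ Set.Icc (0 : ℝ) 1 := fun s =>
    ⟨sub_nonneg.2 (hd s).2, sub_le_self _ (hd s).1⟩
  set ν := ((F ⊗ₘ T.kernel).withDensity (fun p => ENNReal.ofReal (1 - a.discloseProb p.2))).fst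
    with hν
  have hfin : IsFiniteMeasure ν := by
    refine ⟨?_⟩
    rw [hν, Measure.fst_univ, withDensity_apply _ MeasurableSet.univ, Measure.restrict_univ,
      Assessment.lintegral_conceal hm hd]
    exact ENNReal.ofReal_lt_top
  have hac : ν ≪ F := by
    have : ν ≪ (F ⊗ₘ T.kernel).fst :=
      (withDensity_absolutelyContinuous _ _).map measurable_fst
    rwa [Measure.fst_compProd] at this
  have hbd : ∀ ρ : Measure ℝ, IsFiniteMeasure ρ → ρ ≪ F → Integrable (fun θ : ℝ => θ) ρ := by
    intro ρ _ hρ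
    refine Integrable.of_bound (C := max |θl| |θh|) (by fun_prop) ?_
    filter_upwards [hρ.ae_le hF] with s hs using abs_le_max_abs_abs hs.1 hs.2
  have hνint : ∫ θ, θ ∂ν = ∫ s, (1 - a.discloseProb s) * s ∂T.scoreLaw := by
    rw [hν, Measure.fst, integral_map measurable_fst.aemeasurable (by fun_prop),
      integral_withDensity_eq_integral_toReal_smul (by fun_prop)
        (ae_of_all _ fun _ => ENNReal.ofReal_lt_top),
      ← T.integral_mul_eq hF (f := fun s => 1 - a.discloseProb s) (by fun_prop) hd']
    refine integral_congr_ae (ae_of_all _ fun p => ?_)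
    simp only [smul_eq_mul, ENNReal.toReal_ofReal (hd' p.2).1]
  rw [Assessment.nullLaw, ← hν, integral_add_measure
    ((hbd F inferInstance (fun _ h => h)).smul_measure ENNReal.ofReal_ne_top)
    ((hbd ν hfin hac).smul_measure ENNReal.ofReal_ne_top), integral_smul_measure,
    integral_smul_measure, hνint, ENNReal.toReal_ofReal ht.1,
    ENNReal.toReal_ofReal (sub_nonneg.2 ht.2), priorMean]
  rfl

end Test

/-! ### Equilibria with low revenue -/

/-- A positive disclosure fee has a highest threshold. -/
lemma exists_isTopThreshold {G : Measure ℝ} [IsProbabilityMeasure G] {a b d : ℝ}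
    (hG : ∀ᵐ s ∂G, s ∈ Set.Icc a b) (hd : 0 < d) : ∃ τ, IsTopThreshold G d τ := by
  -- The threshold is the supremum of this set. Equality holds there because `H` is 1-Lipschitz
  -- while `G` is monotone: a gap of size `δ` on either side persists over a distance `δ`.
  set S := {x : ℝ | integratedCDF G x ≤ d * cdf G x}
  have hne : S.Nonempty := by
    refine ⟨a, ?_⟩
    change integratedCDF G a ≤ d * cdf G a
    rw [integratedCDF_eq_zero hG le_rfl]
    exact mul_nonneg hd.le (cdf_nonneg _ _)
  have hbdd : BddAbove S := by
    refine ⟨max b ((∫ s, s ∂G) + d), fun x hx => ?_⟩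
    by_contra hlt
    obtain ⟨h1, h2⟩ := max_lt_iff.1 (not_le.1 hlt)
    change integratedCDF G x ≤ d * cdf G x at hx
    rw [integratedCDF_of_ge hG h1.le, cdf_eq_one_of_ae_le hG h1.le] at hx
    linarith
  set τ := sSup S
  have hgt : ∀ x > τ, d * cdf G x < integratedCDF G x := fun x hx =>
    not_le.1 fun h => (le_csSup hbdd h).not_gt hx
  have hle : integratedCDF G τ ≤ d * cdf G τ := by
    by_contra hlt
    have hlt := not_le.1 hlt
    obtain ⟨x, hxS, hx⟩ := exists_lt_of_lt_csSup hne
      (show τ - (integratedCDF G τ - d * cdf G τ) < τ by linarith)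
    have hxτ : x ≤ τ := le_csSup hbdd hxS
    have h1 := integratedCDF_sub_le hG hxτ
    have h2 := mul_le_mul_of_nonneg_left (monotone_cdf G hxτ) hd.le
    change integratedCDF G x ≤ d * cdf G x at hxS
    linarith
  have hge : d * cdf G τ ≤ integratedCDF G τ := by
    by_contra hlt
    have hlt := not_le.1 hlt
    have hx : τ ≤ τ + (d * cdf G τ - integratedCDF G τ) := by linarith
    have h1 := integratedCDF_sub_le hG hx
    have h2 := hgt (τ + (d * cdf G τ - integratedCDF G τ)) (by linarith)
    have h3 := mul_le_mul_of_nonneg_left (monotone_cdf G hx) hd.le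
    linarith
  refine ⟨τ, hd.le, le_antisymm hge hle, fun x hx => (hgt x hx).le, fun _ => ?_⟩
  refine lt_of_le_of_ne (cdf_nonneg _ _) fun h0 => ?_
  rw [← h0, mul_zero] at hle
  have h1 := hgt (τ + d) (by linarith)
  have h2 := integratedCDF_tangent hG (τ + d) τ
  linarith

section Equilibrium

variable {F : Measure ℝ} [IsProbabilityMeasure F] {θl θh : ℝ} {T : UnbiasedTest F}

/-- Beliefs after disclosed scores: the posterior, redefined on a null set so that its mean is the
score throughout. -/
structure IsScoreBelief (T : UnbiasedTest F) (β : ℝ → Measure ℝ) : Prop where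
  prob : ∀ s ∈ T.scores, IsProbabilityMeasure (β s)
  support : ∀ s ∈ T.scores, β s F.supportᶜ = 0
  mean : ∀ s ∈ T.scores, ∫ θ, θ ∂(β s) = s
  posterior : ∀ᵐ s ∂T.scoreLaw, β s = posterior T.kernel F s

/-- On the null set of scores where the posterior has the wrong mean or support, the mixture of the
two extreme values with mean `s` replaces it. -/
lemma exists_isScoreBelief (hθ : θl < θh) (hl : IsLeast F.support θl)
    (hh : IsGreatest F.support θh) (T : UnbiasedTest F) : ∃ β, IsScoreBelief T β := by
  classical
  have hF := ae_mem_of_support_subset (support_subset_Icc hl hh)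
  let good : ℝ → Prop := fun s =>
    posterior T.kernel F s F.supportᶜ = 0 ∧ ∫ θ, θ ∂(posterior T.kernel F s) = s
  let w : ℝ → ℝ := fun s => (s - θl) / (θh - θl)
  let m : ℝ → Measure ℝ := fun s =>
    ENNReal.ofReal (1 - w s) • Measure.dirac θl + ENNReal.ofReal (w s) • Measure.dirac θh
  have hθ' : 0 < θh - θl := sub_pos.2 hθ
  have hw : ∀ s ∈ T.scores, 0 ≤ w s ∧ 0 ≤ 1 - w s := by
    intro s hs
    have hs' := T.scores_subset hF hs
    exact ⟨div_nonneg (sub_nonneg.2 hs'.1) hθ'.le,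
      sub_nonneg.2 ((div_le_one hθ').2 (by linarith [hs'.2]))⟩
  refine ⟨fun s => if good s then posterior T.kernel F s else m s, ?_, ?_, ?_, ?_⟩
  · intro s hs
    by_cases hg : good s
    · simp only [hg, if_true]; infer_instance
    · simp only [hg, if_false]
      refine ⟨?_⟩
      simp only [m, Measure.coe_add, Measure.coe_smul, Pi.add_apply, Pi.smul_apply, smul_eq_mul,
        measure_univ, mul_one]
      rw [← ENNReal.ofReal_add (hw s hs).2 (hw s hs).1]
      simp
  · intro s hs
    by_cases hg : good s
    · simp only [hg, if_true]; exact hg.1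
    · simp only [hg, if_false]
      have hms : MeasurableSet F.supportᶜ := F.isClosed_support.measurableSet.compl
      simp [m, Measure.dirac_apply' _ hms, hl.1, hh.1]
  · intro s hs
    by_cases hg : good s
    · simp only [hg, if_true]; exact hg.2
    · simp only [hg, if_false, m]
      rw [integral_add_measure ((integrable_dirac (by simp)).smul_measure ENNReal.ofReal_ne_top)
        ((integrable_dirac (by simp)).smul_measure ENNReal.ofReal_ne_top),
        integral_smul_measure, integral_smul_measure, integral_dirac, integral_dirac,
        ENNReal.toReal_ofReal (hw s hs).1, ENNReal.toReal_ofReal (hw s hs).2]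
      simp only [w, smul_eq_mul]
      field_simp
      ring
  · filter_upwards [T.unbiased, T.ae_posterior F.support_mem_ae] with s h1 h2
    exact if_pos ⟨h2, h1⟩

lemma integrable_of_support {F : Measure ℝ} (hF : F.support ⊆ Set.Icc θl θh) {ρ : Measure ℝ}
    [IsProbabilityMeasure ρ] (hρ : ρ F.supportᶜ = 0) : Integrable (fun θ : ℝ => θ) ρ := by
  have h : ∀ᵐ θ ∂ρ, θ ∈ F.support := hρ
  exact integrable_of_ae_mem_Icc (h.mono fun θ hθ => hF hθ)

/-- Strategies and a null belief that are mutually optimal extend to an equilibrium. -/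
lemma exists_isPBE (hF : F.support ⊆ Set.Icc θl θh) {φ : Fees} {β : ℝ → Measure ℝ}
    (hβ : IsScoreBelief T β) {a : Assessment} {ν : Measure ℝ} [IsProbabilityMeasure ν]
    (hν : ν F.supportᶜ = 0) {p : ℝ} (hp : ∫ θ, θ ∂ν = p)
    (hbayes : a.nullLaw T Set.univ • ν = a.nullLaw T)
    (hoff : a.nullLaw T = 0 → ∃ s ∈ T.scores, ν = β s)
    (hσ : ∀ s, a.discloseProb s ∈ Set.Icc (0 : ℝ) 1) (hσm : Measurable a.discloseProb)
    (hopt : ∀ s ∈ T.scores, a.discloseProb s * (s - φ.disclosure) + (1 - a.discloseProb s) * p =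
      max (s - φ.disclosure) p)
    (ht : a.testProb = 0 ∧ ∫ s, max (s - (p + φ.disclosure)) 0 ∂T.scoreLaw ≤ φ.testing ∨
      a.testProb = 1 ∧ φ.testing ≤ ∫ s, max (s - (p + φ.disclosure)) 0 ∂T.scoreLaw) :
    ∃ a' : Assessment, IsPBE T φ a' ∧ a'.revenue T φ = a.revenue T φ := by
  let bel : Message → Measure ℝ := fun m => m.elim ν β
  let a' : Assessment := ⟨a.testProb, a.discloseProb, fun _ m => ∫ θ, θ ∂(bel m), fun _ => bel⟩
  have hnull : a'.nullLaw T = a.nullLaw T := rfl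
  have hmsg : ∀ m ∈ T.messages, IsProbabilityMeasure (bel m) ∧ bel m F.supportᶜ = 0 := by
    rintro m (rfl | ⟨s, hs, rfl⟩)
    · exact ⟨‹_›, hν⟩
    · exact ⟨hβ.prob s hs, hβ.support s hs⟩
  have hpn : a'.price none = p := by
    simp only [Assessment.price, a', max_self, bel, Option.elim, hp]
  have hps : ∀ s ∈ T.scores, a'.price (some s) = s := fun s hs => by
    simp only [Assessment.price, a', max_self, bel, Option.elim, hβ.mean s hs]
  have hTae := T.ae_mem_Icc (ae_mem_of_support_subset hF)
  have hpay : ∀ s ∈ T.scores,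
      a'.disclosurePayoff φ s (a'.discloseProb s) = max (s - φ.disclosure) p := fun s hs => by
    rw [Assessment.disclosurePayoff, hps s hs, hpn, ← hopt s hs]
  have hint : ∫ s, a'.disclosurePayoff φ s (a'.discloseProb s) ∂T.scoreLaw =
      (∫ s, max (s - (p + φ.disclosure)) 0 ∂T.scoreLaw) + p := by
    have h1 : ∀ᵐ s ∂T.scoreLaw, a'.disclosurePayoff φ s (a'.discloseProb s) =
        max (s - (p + φ.disclosure)) 0 + p := by
      filter_upwards [T.ae_mem_scores] with s hs
      rw [hpay s hs, max_add]
      congr 1 <;> ring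
    rw [integral_congr_ae h1, integral_add _ (integrable_const p)]
    · simp
    · exact ((integrable_of_ae_mem_Icc hTae).sub (integrable_const _)).sup (integrable_const 0)
  refine ⟨a', ⟨?_, hσ, hσm, fun _ m hm => (hmsg m hm).1, fun _ m hm => (hmsg m hm).2,
    fun _ _ => rfl, fun _ => hβ.posterior, fun _ s hs => hβ.mean s hs, fun _ => hbayes,
    fun _ h0 => ?_, fun m hm b => ?_, fun s hs d hd => ?_, fun t ht' => ?_⟩, rfl⟩
  · change a.testProb ∈ _
    rcases ht with h | h <;> rw [h.1] <;> norm_num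
  · obtain ⟨s, hs, hνs⟩ := hoff h0
    refine ⟨1, by norm_num, Measure.dirac s, inferInstance, ?_, ?_⟩
    · have : MeasurableSet T.scoresᶜ :=
        (Measure.isClosed_support (μ := T.scoreLaw)).measurableSet.compl
      simp [Measure.dirac_apply' _ this, hs]
    · have hb : (Measure.dirac s).bind β = β s := by
        ext A hA
        -- `β` need not be measurable, but under the point mass at `s` it agrees almost everywhere
        -- with a constant.
        rw [Measure.bind_apply hA ⟨fun _ => β s, measurable_const, by
          rw [Filter.EventuallyEq, ae_dirac_eq]; rfl⟩]
        exact lintegral_dirac _ _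
      change ν = ENNReal.ofReal (1 - 1) • F + ENNReal.ofReal 1 • (Measure.dirac s).bind β
      rw [hb, hνs]
      simp
  · have := (hmsg m hm).1
    have := buyerPayoff_le_of_eq_mean (integrable_of_support hF (hmsg m hm).2) b
    exact ⟨this, this⟩
  · rw [hpay s hs, Assessment.disclosurePayoff, hps s hs, hpn]
    have h1 := mul_le_mul_of_nonneg_left (le_max_left (s - φ.disclosure) p) hd.1
    have h2 := mul_le_mul_of_nonneg_left (le_max_right (s - φ.disclosure) p) (sub_nonneg.2 hd.2)
    linarith
  · rw [Assessment.agentPayoff, Assessment.agentPayoff, hint, hpn]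
    change _ ≤ a.testProb * _ + (1 - a.testProb) * p
    rcases ht with ⟨h, h'⟩ | ⟨h, h'⟩ <;> rw [h]
    · nlinarith [ht'.1]
    · nlinarith [ht'.2]

lemma indicator_one_mem (A : Set ℝ) (s : ℝ) :
    A.indicator (fun _ => (1 : ℝ)) s ∈ Set.Icc (0 : ℝ) 1 := by
  by_cases h : s ∈ A <;> simp [h]

lemma disclose_above_optimal {x d p : ℝ} (hx : x = p + d) (s : ℝ) :
    (Set.Ioi x).indicator (fun _ => (1 : ℝ)) s * (s - d) +
      (1 - (Set.Ioi x).indicator (fun _ => (1 : ℝ)) s) * p = max (s - d) p := by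
  rcases le_or_gt s x with h | h
  · rw [Set.indicator_of_notMem (by simpa using h), max_eq_right (by linarith)]
    ring
  · rw [Set.indicator_of_mem (by exact h), max_eq_left (by linarith)]
    ring

lemma integral_indicator_Ioi (G : Measure ℝ) [IsProbabilityMeasure G] (x : ℝ) :
    ∫ s, (Set.Ioi x).indicator (fun _ => (1 : ℝ)) s ∂G = 1 - cdf G x := by
  rw [integral_indicator measurableSet_Ioi, setIntegral_const, cdf_eq_real, ← Set.compl_Iic,
    probReal_compl_eq_one_sub measurableSet_Iic]
  simp

/-- If the testing fee is too high, then not testing is an equilibrium. -/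
lemma exists_isPBE_of_testing_high (hθ : θl < θh) (hl : IsLeast F.support θl)
    (hh : IsGreatest F.support θh) {φ : Fees}
    (h : ∫ s, max (s - (priorMean F + φ.disclosure)) 0 ∂T.scoreLaw ≤ φ.testing) :
    ∃ a, IsPBE T φ a ∧ a.revenue T φ = 0 := by
  have hF := support_subset_Icc hl hh
  obtain ⟨β, hβ⟩ := exists_isScoreBelief hθ hl hh T
  let a : Assessment := ⟨0, (Set.Ioi (priorMean F + φ.disclosure)).indicator fun _ => 1,
    fun _ _ => 0, fun _ _ => 0⟩
  have hnull : a.nullLaw T = F := by simp [Assessment.nullLaw, a]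
  obtain ⟨a', h1, h2⟩ := exists_isPBE (T := T) (φ := φ) hF hβ (a := a) (ν := F)
    F.measure_compl_support (p := priorMean F) rfl (by rw [hnull]; simp)
    (fun h0 => by
      rw [hnull] at h0
      exact absurd h0 (IsProbabilityMeasure.ne_zero F))
    (indicator_one_mem _) (measurable_const.indicator measurableSet_Ioi)
    (fun s _ => disclose_above_optimal rfl s) (Or.inl ⟨rfl, h⟩)
  exact ⟨a', h1, by rw [h2]; simp [Assessment.revenue, a]⟩

/-- With a positive disclosure fee and a low testing fee, testing and disclosing the scores above
the top threshold is an equilibrium. -/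
lemma exists_isPBE_of_isTopThreshold (hθ : θl < θh) (hl : IsLeast F.support θl)
    (hh : IsGreatest F.support θh) {φ : Fees} {τ : ℝ} (hd : 0 < φ.disclosure)
    (hτ : IsTopThreshold T.scoreLaw φ.disclosure τ)
    (h : φ.testing ≤ ∫ s, max (s - (priorMean F + φ.disclosure)) 0 ∂T.scoreLaw) :
    ∃ a, IsPBE T φ a ∧
      a.revenue T φ = φ.testing + φ.disclosure * (1 - cdf T.scoreLaw τ) := by
  have hF := support_subset_Icc hl hh
  have hFae := ae_mem_of_support_subset hF
  have hTae := T.ae_mem_Icc hFae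
  have hi := integrable_of_ae_mem_Icc hTae
  obtain ⟨β, hβ⟩ := exists_isScoreBelief hθ hl hh T
  set N := cdf T.scoreLaw τ with hN
  have hN0 : 0 < N := hτ.pos hd
  let a : Assessment := ⟨1, (Set.Ioi τ).indicator fun _ => 1, fun _ _ => 0, fun _ _ => 0⟩
  have ham : Measurable a.discloseProb := measurable_const.indicator measurableSet_Ioi
  have ha1 : ∀ s, a.discloseProb s ∈ Set.Icc (0 : ℝ) 1 := indicator_one_mem _
  have hat : a.testProb ∈ Set.Icc (0 : ℝ) 1 := by simp [a]
  have hσint : ∫ s, a.discloseProb s ∂T.scoreLaw = 1 - N := integral_indicator_Ioi _ τ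
  have huniv : a.nullLaw T Set.univ = ENNReal.ofReal N := by
    rw [Assessment.nullLaw_univ hat ham ha1, hσint]
    congr 1
    simp [a]
  have hN0' : ENNReal.ofReal N ≠ 0 := by simpa using hN0
  set ν : Measure ℝ := (ENNReal.ofReal N)⁻¹ • a.nullLaw T with hν
  have hprob : IsProbabilityMeasure ν := by
    refine ⟨?_⟩
    rw [hν, Measure.smul_apply, huniv, smul_eq_mul,
      ENNReal.inv_mul_cancel hN0' ENNReal.ofReal_ne_top]
  have hmean : ∫ θ, θ ∂ν = τ - φ.disclosure := by
    rw [hν, integral_smul_measure, Assessment.integral_nullLaw hFae hat ham ha1]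
    have h1 : ∫ s, (1 - a.discloseProb s) * s ∂T.scoreLaw =
        τ * N - integratedCDF T.scoreLaw τ := by
      rw [integratedCDF_eq_setIntegral, integral_sub (integrable_const _) hi.integrableOn,
        ← integral_indicator measurableSet_Iic, ← integral_indicator measurableSet_Iic,
        integral_Iic_indicator, mul_comm τ, sub_sub_cancel]
      congr 1
      funext s
      by_cases hs : s ≤ τ
      · simp [a, Set.indicator, hs, not_lt.2 hs]
      · simp [a, Set.indicator, hs, not_le.1 hs]
    rw [h1, ← hτ.eq, ENNReal.toReal_inv, ENNReal.toReal_ofReal hN0.le]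
    simp only [a, sub_self, zero_mul, zero_add, one_mul, smul_eq_mul]
    field_simp
    rw [← hN]
    ring
  -- The null price is at most the prior mean, so testing is worth at least what the hypothesis on
  -- the testing fee assumes.
  have hpμ : τ - φ.disclosure ≤ priorMean F := by
    have h1 := sub_mean_le_integratedCDF hTae τ
    rw [T.mean_scoreLaw hFae, ← hτ.eq] at h1
    have h2 : N ≤ 1 := cdf_le_one _ _
    nlinarith
  have hopt : ∫ s, max (s - (priorMean F + φ.disclosure)) 0 ∂T.scoreLaw ≤
      ∫ s, max (s - (τ - φ.disclosure + φ.disclosure)) 0 ∂T.scoreLaw :=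
    integral_mono ((hi.sub (integrable_const _)).sup (integrable_const 0))
      ((hi.sub (integrable_const _)).sup (integrable_const 0))
      fun s => max_le_max (by linarith) le_rfl
  obtain ⟨a', h1, h2⟩ := exists_isPBE (T := T) (φ := φ) hF hβ (a := a) (ν := ν) (by
      have : ∀ᵐ θ ∂(a.nullLaw T), θ ∈ F.support := a.ae_nullLaw F.support_mem_ae
      exact Measure.ae_smul_measure this _) hmean
    (by rw [huniv, hν, smul_smul, ENNReal.mul_inv_cancel hN0' ENNReal.ofReal_ne_top, one_smul])
    (fun h0 => by
      rw [h0] at huniv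
      exact absurd huniv.symm hN0')
    ha1 ham (fun s _ => disclose_above_optimal (by ring) s) (Or.inr ⟨rfl, h.trans hopt⟩)
  refine ⟨a', h1, ?_⟩
  rw [h2, Assessment.revenue, hσint]
  simp [a]

/-- If disclosure is subsidized, then full disclosure is an equilibrium. -/
lemma exists_isPBE_of_disclosure_nonpos (hθ : θl < θh) (hl : IsLeast F.support θl)
    (hh : IsGreatest F.support θh) {φ : Fees} (hd : φ.disclosure ≤ 0)
    (h : φ.testing ≤ ∫ s, max (s - (priorMean F + φ.disclosure)) 0 ∂T.scoreLaw) :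
    ∃ a, IsPBE T φ a ∧ a.revenue T φ = φ.testing + φ.disclosure := by
  have hF := support_subset_Icc hl hh
  have hFae := ae_mem_of_support_subset hF
  have hTae := T.ae_mem_Icc hFae
  have hi := integrable_of_ae_mem_Icc hTae
  obtain ⟨β, hβ⟩ := exists_isScoreBelief hθ hl hh T
  have hbdd : BddBelow T.scores := ⟨θl, fun s hs => (T.scores_subset hFae hs).1⟩
  set L := sInf T.scores with hL
  have hLmem : L ∈ T.scores := (Measure.isClosed_support (μ := T.scoreLaw)).csInf_mem
    (Measure.nonempty_support (IsProbabilityMeasure.ne_zero T.scoreLaw)) hbdd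
  have hLle : ∀ s ∈ T.scores, L ≤ s := fun s hs => csInf_le hbdd hs
  have hLμ : L ≤ priorMean F := by
    rw [← T.mean_scoreLaw hFae]
    have := integral_mono_ae (integrable_const L) hi (T.ae_mem_scores.mono hLle)
    simpa using this
  let a : Assessment := ⟨1, fun _ => 1, fun _ _ => 0, fun _ _ => 0⟩
  have hnull : a.nullLaw T = 0 := by simp [Assessment.nullLaw, a]
  have := hβ.prob L hLmem
  have hopt : ∫ s, max (s - (priorMean F + φ.disclosure)) 0 ∂T.scoreLaw ≤
      ∫ s, max (s - (L + φ.disclosure)) 0 ∂T.scoreLaw :=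
    integral_mono ((hi.sub (integrable_const _)).sup (integrable_const 0))
      ((hi.sub (integrable_const _)).sup (integrable_const 0))
      fun s => max_le_max (by linarith) le_rfl
  -- The null message is off the path and is attributed to the lowest score, so no score gains by
  -- concealment.
  obtain ⟨a', h1, h2⟩ := exists_isPBE (T := T) (φ := φ) hF hβ (a := a) (ν := β L)
    (hβ.support L hLmem) (hβ.mean L hLmem) (by rw [hnull]; simp) (fun _ => ⟨L, hLmem, rfl⟩)
    (fun _ => by simp [a]) measurable_const
    (fun s hs => by
      have := hLle s hs
      rw [max_eq_left (by linarith)]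
      simp [a]) (Or.inr ⟨rfl, h.trans hopt⟩)
  exact ⟨a', h1, by rw [h2]; simp [Assessment.revenue, a]⟩

/-- The revenue from testing fees alone is below the two-point bound. -/
lemma integratedCDF_mean_le {G : Measure ℝ} [IsProbabilityMeasure G] {a b μ : ℝ}
    (hG : ∀ᵐ s ∂G, s ∈ Set.Icc a b) (hμ : ∫ s, s ∂G = μ) (ha : a < μ) (hb : μ < b) :
    integratedCDF G μ ≤ (b - μ) * (1 - Real.exp ((a - μ) / (b - μ))) := by
  have h1 := integratedCDF_le_chord hG (x := μ) ⟨ha.le, hb.le⟩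
  rw [hμ] at h1
  have hbμ : 0 < b - μ := by linarith
  have hba : 0 < b - a := by linarith
  have h2 := Real.add_one_le_exp ((μ - a) / (b - μ))
  have h3 : (μ - a) / (b - μ) + 1 = (b - a) / (b - μ) := by field_simp; ring
  have h4 : Real.exp ((a - μ) / (b - μ)) ≤ (b - μ) / (b - a) := by
    have e : (a - μ) / (b - μ) = -((μ - a) / (b - μ)) := by rw [← neg_div, neg_sub]
    rw [e, Real.exp_neg, ← inv_div (b - a)]
    rw [h3] at h2
    exact inv_anti₀ (div_pos hba hbμ) h2
  have h5 : 1 - (b - μ) / (b - a) = (μ - a) / (b - a) := by field_simp; ring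
  calc integratedCDF G μ ≤ (b - μ) * ((μ - a) / (b - a)) := by
        rw [mul_div_assoc', le_div_iff₀ hba]; linarith
    _ ≤ _ := mul_le_mul_of_nonneg_left (by linarith) hbμ.le

theorem revenueGuarantee_le (hθ : θl < θh) (hl : IsLeast F.support θl)
    (hh : IsGreatest F.support θh) (T : UnbiasedTest F) (φ : Fees) :
    revenueGuarantee T φ ≤
      (((θh - priorMean F) *
        (1 - Real.exp ((θl - priorMean F) / (θh - priorMean F))) : ℝ) : EReal) := by
  have hF := support_subset_Icc hl hh
  have hFae := ae_mem_of_support_subset hF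
  have hTae := T.ae_mem_Icc hFae
  have hmean := T.mean_scoreLaw hFae
  have hlμ := lt_priorMean hθ hl hh
  have hμh := priorMean_lt hθ hl hh
  have hbound := integratedCDF_mean_le hTae hmean hlμ hμh
  suffices ∃ a, IsPBE T φ a ∧ a.revenue T φ ≤ (θh - priorMean F) *
      (1 - Real.exp ((θl - priorMean F) / (θh - priorMean F))) by
    obtain ⟨a, ha, hr⟩ := this
    exact iInf₂_le_of_le a ha (EReal.coe_le_coe_iff.2 hr)
  have heq := integral_max_sub_eq hTae (priorMean F + φ.disclosure)
  rw [hmean] at heq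
  rcases le_total (∫ s, max (s - (priorMean F + φ.disclosure)) 0 ∂T.scoreLaw) φ.testing with h | h
  · obtain ⟨a, ha, hr⟩ := exists_isPBE_of_testing_high hθ hl hh h
    exact ⟨a, ha, by rw [hr]; exact (integratedCDF_nonneg _).trans hbound⟩
  rcases le_or_gt φ.disclosure 0 with hd | hd
  · obtain ⟨a, ha, hr⟩ := exists_isPBE_of_disclosure_nonpos hθ hl hh hd h
    refine ⟨a, ha, ?_⟩
    rw [hr]
    have h1 := integratedCDF_mono hTae
      (show priorMean F + φ.disclosure ≤ priorMean F by linarith)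
    linarith
  · obtain ⟨τ, hτ⟩ := exists_isTopThreshold hTae hd
    obtain ⟨a, ha, hr⟩ := exists_isPBE_of_isTopThreshold hθ hl hh hd hτ h
    refine ⟨a, ha, ?_⟩
    rw [hr]
    have h1 := hτ.revenue_le (t := φ.testing) (by rw [hmean]; linarith)
    rw [hmean] at h1
    exact h1.trans (hτ.revenue_bound hTae hd hmean hlμ hμh)

end Equilibrium

/-! ### Tests of a binary asset -/

section Binary

variable {F : Measure ℝ} [IsProbabilityMeasure F] {θl θh : ℝ}

lemma eq_smul_dirac_add_smul_dirac {F : Measure ℝ} (hθ : θl < θh) (hF : F.support = {θl, θh}) :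
    F = F {θl} • Measure.dirac θl + F {θh} • Measure.dirac θh := by
  have h : F.restrict {θl, θh} = F := by
    refine Measure.restrict_eq_self_of_ae_mem ?_
    have := F.support_mem_ae
    rwa [hF] at this
  conv_lhs => rw [← h]
  rw [Set.insert_eq, Measure.restrict_union (by simpa using hθ.ne) (measurableSet_singleton _),
    Measure.restrict_singleton, Measure.restrict_singleton]

lemma integral_binary (hθ : θl < θh) (hF : F.support = {θl, θh}) (f : ℝ → ℝ) :
    ∫ θ, f θ ∂F = F.real {θl} * f θl + F.real {θh} * f θh := by
  rw [eq_smul_dirac_add_smul_dirac hθ hF,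
    integral_add_measure ((integrable_dirac (by simp)).smul_measure (measure_ne_top _ _))
      ((integrable_dirac (by simp)).smul_measure (measure_ne_top _ _)),
    integral_smul_measure, integral_smul_measure, integral_dirac, integral_dirac,
    ← eq_smul_dirac_add_smul_dirac hθ hF]
  rfl

lemma binary_weights (hθ : θl < θh) (hF : F.support = {θl, θh}) :
    F.real {θl} * (θh - θl) = θh - priorMean F ∧ F.real {θh} * (θh - θl) = priorMean F - θl := by
  have h1 : 1 = F.real {θl} * 1 + F.real {θh} * 1 := by
    rw [← integral_binary hθ hF (fun _ => 1)]
    simp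
  have h2 : priorMean F = F.real {θl} * θl + F.real {θh} * θh := integral_binary hθ hF _
  have h3 : F.real {θl} = 1 - F.real {θh} := by linarith
  rw [h3] at h2 ⊢
  constructor <;> linarith

lemma isProbabilityMeasure_withDensity_ofReal {G : Measure ℝ} {w : ℝ → ℝ}
    (hi : Integrable w G) (hw : ∀ᵐ s ∂G, 0 ≤ w s) (h1 : ∫ s, w s ∂G = 1) :
    IsProbabilityMeasure (G.withDensity fun s => ENNReal.ofReal (w s)) := by
  refine ⟨?_⟩
  rw [withDensity_apply _ MeasurableSet.univ, Measure.restrict_univ,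
    ← ofReal_integral_eq_lintegral_ofReal hi hw, h1, ENNReal.ofReal_one]

lemma integral_withDensity_ofReal {G : Measure ℝ} {w : ℝ → ℝ} (hm : Measurable w)
    (hw : ∀ᵐ s ∂G, 0 ≤ w s) (f : ℝ → ℝ) :
    ∫ s, f s ∂(G.withDensity fun s => ENNReal.ofReal (w s)) = ∫ s, w s * f s ∂G := by
  rw [integral_withDensity_eq_integral_toReal_smul (by fun_prop)
    (ae_of_all _ fun _ => ENNReal.ofReal_lt_top)]
  refine integral_congr_ae ?_
  filter_upwards [hw] with s hs
  rw [ENNReal.toReal_ofReal hs, smul_eq_mul]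

/-- Every score distribution with the right mean comes from a test of a binary asset. -/
theorem exists_unbiasedTest_binary (hθ : θl < θh) (hF : F.support = {θl, θh}) {G : Measure ℝ}
    [IsProbabilityMeasure G] (hG : ∀ᵐ s ∂G, s ∈ Set.Icc θl θh)
    (hmean : ∫ s, s ∂G = priorMean F) : ∃ T : UnbiasedTest F, T.scoreLaw = G := by
  have hl : IsLeast F.support θl := by
    rw [hF]
    exact ⟨by simp, by rintro x (rfl | rfl); exacts [le_rfl, hθ.le]⟩
  have hh : IsGreatest F.support θh := by
    rw [hF]
    exact ⟨by simp, by rintro x (rfl | rfl); exacts [hθ.le, le_rfl]⟩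
  have hFae := ae_mem_of_support_subset (support_subset_Icc hl hh)
  have hlμ := sub_pos.2 (lt_priorMean hθ hl hh)
  have hμh := sub_pos.2 (priorMean_lt hθ hl hh)
  obtain ⟨hwl, hwh⟩ := binary_weights hθ hF
  have hθ' : 0 < θh - θl := sub_pos.2 hθ
  set μ := priorMean F
  have hi := integrable_of_ae_mem_Icc hG
  -- Bayes' rule read backwards: `wl` and `wh` are the posterior weights of the two values at mean
  -- `s` divided by their prior weights, hence the densities of the score given each value.
  set wl : ℝ → ℝ := fun s => (θh - s) / (θh - μ) with hwl_def
  set wh : ℝ → ℝ := fun s => (s - θl) / (μ - θl) with hwh_def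
  have hwlm : Measurable wl := by fun_prop
  have hwhm : Measurable wh := by fun_prop
  have hwl0 : ∀ᵐ s ∂G, 0 ≤ wl s := by
    filter_upwards [hG] with s hs using div_nonneg (sub_nonneg.2 hs.2) hμh.le
  have hwh0 : ∀ᵐ s ∂G, 0 ≤ wh s := by
    filter_upwards [hG] with s hs using div_nonneg (sub_nonneg.2 hs.1) hlμ.le
  have hwli : Integrable wl G := ((integrable_const _).sub hi).div_const _
  have hwhi : Integrable wh G := (hi.sub (integrable_const _)).div_const _
  have hl1 : ∫ s, wl s ∂G = 1 := by
    rw [hwl_def, integral_div, integral_sub (integrable_const _) hi, hmean]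
    simp only [integral_const, probReal_univ, smul_eq_mul, one_mul]
    exact div_self hμh.ne'
  have hh1 : ∫ s, wh s ∂G = 1 := by
    rw [hwh_def, integral_div, integral_sub hi (integrable_const _), hmean]
    simp only [integral_const, probReal_univ, smul_eq_mul, one_mul]
    exact div_self hlμ.ne'
  have hsum : ∀ s, F.real {θl} * wl s + F.real {θh} * wh s = 1 := by
    intro s
    have e1 : F.real {θl} * wl s = (θh - s) / (θh - θl) := by
      rw [hwl_def, eq_div_iff hθ'.ne', mul_right_comm, hwl]
      field_simp
    have e2 : F.real {θh} * wh s = (s - θl) / (θh - θl) := by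
      rw [hwh_def, eq_div_iff hθ'.ne', mul_right_comm, hwh]
      field_simp
    rw [e1, e2, ← add_div]
    field_simp
    ring
  have hsum' : ∀ s, F.real {θl} * (wl s * θl) + F.real {θh} * (wh s * θh) = s := by
    intro s
    have e2 : F.real {θh} * wh s * (θh - θl) = s - θl := by
      rw [hwh_def, mul_right_comm, hwh]
      field_simp
    linear_combination θl * hsum s + e2
  set Gl := G.withDensity fun s => ENNReal.ofReal (wl s) with hGl
  set Gh := G.withDensity fun s => ENNReal.ofReal (wh s) with hGh
  have hPl : IsProbabilityMeasure Gl := isProbabilityMeasure_withDensity_ofReal hwli hwl0 hl1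
  have hPh : IsProbabilityMeasure Gh := isProbabilityMeasure_withDensity_ofReal hwhi hwh0 hh1
  set κ : Kernel ℝ ℝ := Kernel.piecewise (measurableSet_singleton θh) (Kernel.const ℝ Gh)
    (Kernel.const ℝ Gl) with hκ
  have hκm : IsMarkovKernel κ := by rw [hκ]; infer_instance
  have hκl : κ θl = Gl := by
    rw [hκ, Kernel.piecewise_apply, if_neg (by simpa using hθ.ne), Kernel.const_apply]
  have hκh : κ θh = Gh := by
    rw [hκ, Kernel.piecewise_apply, if_pos (Set.mem_singleton _), Kernel.const_apply]
  have hlaw : κ ∘ₘ F = G := by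
    ext A hA
    have h0 : (κ ∘ₘ F) A = F {θl} * Gl A + F {θh} * Gh A := by
      rw [Measure.bind_apply hA κ.measurable.aemeasurable]
      conv_lhs => rw [eq_smul_dirac_add_smul_dirac hθ hF]
      rw [lintegral_add_measure, lintegral_smul_measure, lintegral_smul_measure, lintegral_dirac,
        lintegral_dirac, hκl, hκh]
      rfl
    rw [h0, hGl, hGh, withDensity_apply _ hA, withDensity_apply _ hA,
      ← lintegral_const_mul _ (by fun_prop), ← lintegral_const_mul _ (by fun_prop),
      ← lintegral_add_left (by fun_prop)]
    rw [lintegral_congr_ae (g := fun _ => 1)]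
    · simp
    · filter_upwards [ae_restrict_of_ae hwl0, ae_restrict_of_ae hwh0] with s h1 h2
      rw [← ofReal_measureReal (measure_ne_top F {θl}), ← ofReal_measureReal (measure_ne_top F {θh}),
        ← ENNReal.ofReal_mul measureReal_nonneg, ← ENNReal.ofReal_mul measureReal_nonneg,
        ← ENNReal.ofReal_add (mul_nonneg measureReal_nonneg h1)
          (mul_nonneg measureReal_nonneg h2), hsum, ENNReal.ofReal_one]
  refine ⟨⟨κ, hκm, ?_⟩, hlaw⟩
  have hpost := ae_ae_posterior (κ := κ) hFae
  have hpm : Integrable (fun s => ∫ θ, θ ∂(posterior κ F s)) (κ ∘ₘ F) := by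
    refine Integrable.of_bound (C := max |θl| |θh|) ?_ ?_
    · exact (StronglyMeasurable.integral_kernel_prod_right'
        (f := fun q : ℝ × ℝ => q.2) measurable_snd.stronglyMeasurable).aestronglyMeasurable
    · filter_upwards [hpost] with s hs
      refine (norm_integral_le_of_norm_le_const (C := max |θl| |θh|)
        (hs.mono fun θ hθ => abs_le_max_abs_abs hθ.1 hθ.2)).trans ?_
      simp
  -- Unbiasedness is checked on sets `A` by computing the expectation of the value on the event that
  -- the score is in `A` in two ways: through the posterior, and through the kernel.
  refine ae_eq_of_forall_setIntegral_eq_of_sigmaFinite (fun _ _ _ => hpm.integrableOn)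
    (fun _ _ _ => by rw [hlaw]; exact hi.integrableOn) fun A hA _ => ?_
  have hf1 : Measurable (A.indicator fun _ => (1 : ℝ)) := measurable_const.indicator hA
  have h := (integral_mul_posterior_mean (κ := κ) hFae hf1 (indicator_one_mem A)).symm.trans
    (Measure.integral_compProd (integrable_mul_fst_compProd hFae hf1 (indicator_one_mem A)))
  simp only [integral_mul_const] at h
  rw [integral_binary hθ hF, hκl, hκh, hGl, hGh, integral_withDensity_ofReal hwlm hwl0,
    integral_withDensity_ofReal hwhm hwh0] at h
  have hind : ∀ g : ℝ → ℝ, (fun s => A.indicator (fun _ => (1 : ℝ)) s * g s) = A.indicator g := by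
    intro g
    funext s
    by_cases hs : s ∈ A <;> simp [hs]
  have hind' : ∀ g : ℝ → ℝ, (fun s => g s * A.indicator (fun _ => (1 : ℝ)) s) = A.indicator g := by
    intro g
    funext s
    by_cases hs : s ∈ A <;> simp [hs]
  rw [hind, hind', hind', integral_indicator hA, integral_indicator hA, integral_indicator hA] at h
  rw [h, hlaw, ← integral_mul_const, ← integral_mul_const, ← integral_const_mul,
    ← integral_const_mul, ← integral_add
      ((hwli.integrableOn.mul_const _).const_mul _) ((hwhi.integrableOn.mul_const _).const_mul _)]
  simp only [hsum']

end Binary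

/-! ### All equilibria of a test-fee structure with a low testing fee -/

section AllEquilibria

variable {F : Measure ℝ} [IsProbabilityMeasure F] {θl θh : ℝ} {T : UnbiasedTest F} {φ : Fees}
  {a : Assessment}

lemma IsPBE.price_eq (hF : F.support ⊆ Set.Icc θl θh) (h : IsPBE T φ a) {m : Message}
    (hm : m ∈ T.messages) : a.price m = ∫ θ, θ ∂(a.belief 0 m) := by
  have := h.belief_prob 0 m hm
  refine bids_eq_mean (integrable_of_support hF (h.belief_support 0 m hm)) fun b => ?_
  have := h.bid_optimal m hm b
  rwa [← h.belief_common m hm] at this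

lemma IsPBE.price_some (hF : F.support ⊆ Set.Icc θl θh) (h : IsPBE T φ a) {s : ℝ}
    (hs : s ∈ T.scores) : a.price (some s) = s := by
  rw [h.price_eq hF (Set.mem_insert_of_mem _ ⟨s, hs, rfl⟩), h.belief_score_mean 0 s hs]

/-- In every equilibrium of a structure with a positive disclosure fee and a low testing fee, the
asset is tested and a threshold separates disclosed from concealed scores. -/
lemma IsPBE.exists_threshold (hF : F.support ⊆ Set.Icc θl θh) (h : IsPBE T φ a)
    (hd : 0 < φ.disclosure)
    (ht : φ.testing < ∫ s, max (s - (priorMean F + φ.disclosure)) 0 ∂T.scoreLaw) :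
    a.testProb = 1 ∧ ∃ τ,
      integratedCDF T.scoreLaw τ =
        φ.disclosure * (1 - ∫ s, a.discloseProb s ∂T.scoreLaw) ∧
      1 - ∫ s, a.discloseProb s ∂T.scoreLaw ≤ cdf T.scoreLaw τ := by
  have hFae := ae_mem_of_support_subset hF
  have hTae := T.ae_mem_Icc hFae
  have hi := integrable_of_ae_mem_Icc hTae
  have hmean := T.mean_scoreLaw hFae
  set G := T.scoreLaw with hG
  set σ := a.discloseProb with hσ
  set p := a.price none with hp
  set μ := priorMean F
  set d := φ.disclosure
  have hσ1 := h.discloseProb_mem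
  have hσi : Integrable σ G := integrable_of_mem_Icc_zero_one h.discloseProb_measurable hσ1
  have hσsi : Integrable (fun s => σ s * s) G := by
    refine hi.bdd_mul (c := 1) h.discloseProb_measurable.aestronglyMeasurable
      (ae_of_all _ fun s => ?_)
    rw [Real.norm_eq_abs, abs_of_nonneg (hσ1 s).1]
    exact (hσ1 s).2
  have hpay : ∀ s ∈ T.scores, ∀ e, a.disclosurePayoff φ s e = e * (s - d) + (1 - e) * p :=
    fun s hs e => by rw [Assessment.disclosurePayoff, h.price_some hF hs]
  have hopt : ∀ s ∈ T.scores, σ s * (s - d) + (1 - σ s) * p = max (s - d) p := by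
    intro s hs
    have h1 := h.disclose_optimal s hs 1 (by norm_num)
    have h0 := h.disclose_optimal s hs 0 (by norm_num)
    rw [hpay s hs, hpay s hs] at h0 h1
    refine le_antisymm ?_ (max_le (by linarith) (by linarith))
    have h1 := mul_le_mul_of_nonneg_left (le_max_left (s - d) p) (hσ1 s).1
    have h2 := mul_le_mul_of_nonneg_left (le_max_right (s - d) p) (sub_nonneg.2 (hσ1 s).2)
    change σ s * _ ≤ _ at h1
    change (1 - σ s) * _ ≤ _ at h2
    linarith
  -- Bayes' rule at the null message
  have hbayes : (1 - a.testProb) * (μ - p) +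
      a.testProb * ∫ s, (1 - σ s) * (s - p) ∂G = 0 := by
    have hN := Assessment.nullLaw_univ (T := T) h.testProb_mem h.discloseProb_measurable hσ1
    have hI := Assessment.integral_nullLaw (T := T) hFae h.testProb_mem
      h.discloseProb_measurable hσ1
    have hb := h.belief_null 0
    have hpn : p = ∫ θ, θ ∂(a.belief 0 none) := h.price_eq hF (Set.mem_insert _ _)
    have hS : ∫ s, σ s ∂G ≤ 1 := by
      have := integral_mono hσi (integrable_const 1) fun s => (hσ1 s).2
      simpa using this
    rw [← hb, integral_smul_measure, hN, ← hpn, ENNReal.toReal_ofReal (add_nonneg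
      (sub_nonneg.2 h.testProb_mem.2) (mul_nonneg h.testProb_mem.1 (sub_nonneg.2 hS)))] at hI
    have h3 : ∫ s, (1 - σ s) * (s - p) ∂G =
        (∫ s, (1 - σ s) * s ∂G) - p * (1 - ∫ s, σ s ∂G) := by
      have e1 : (1 - ∫ s, σ s ∂G) = ∫ s, (1 - σ s) ∂G := by
        rw [integral_sub (integrable_const 1) hσi]
        simp
      have e2 : Integrable (fun s => (1 - σ s) * s) G := by
        simp only [sub_mul, one_mul]
        exact hi.sub hσsi
      rw [e1, ← integral_const_mul, ← integral_sub (g := fun s => p * (1 - σ s)) e2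
        (((integrable_const 1).sub hσi).const_mul p)]
      congr 1
      funext s
      ring
    rw [h3]
    simp only [smul_eq_mul] at hI
    linarith
  have hsp : Integrable (fun s => σ s * (s - p)) G := by
    simp only [mul_sub]
    exact hσsi.sub (hσi.mul_const p)
  -- Disclosed scores are at least `p + d > p`, so removing them from the pool cannot lift the null
  -- price above the prior mean.
  have hpμ : p ≤ μ := by
    by_contra hlt
    have hlt := not_le.1 hlt
    have h1 : 0 ≤ ∫ s, σ s * (s - p) ∂G := by
      refine integral_nonneg_of_ae ?_
      filter_upwards [T.ae_mem_scores] with s hs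
      have h2 := hopt s hs
      have h3 := le_max_right (s - d) p
      rcases (hσ1 s).1.eq_or_lt with h0 | h0
      · change 0 ≤ σ s * (s - p)
        rw [hσ, ← h0, zero_mul]
      · refine mul_nonneg h0.le ?_
        have h4 : 0 ≤ a.discloseProb s * (s - d - p) := by
          have : a.discloseProb s * (s - d) + (1 - a.discloseProb s) * p = max (s - d) p := h2
          linarith
        have := nonneg_of_mul_nonneg_right h4 h0
        linarith
    have h2 : ∫ s, (1 - σ s) * (s - p) ∂G = (μ - p) - ∫ s, σ s * (s - p) ∂G := by
      have : ∀ s, (1 - σ s) * (s - p) = (s - p) - σ s * (s - p) := fun s => by ring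
      simp only [this]
      rw [integral_sub (f := fun s => s - p) (hi.sub (integrable_const p)) hsp, integral_sub hi (integrable_const p),
        hmean]
      simp
    rw [h2] at hbayes
    have := h.testProb_mem.1
    nlinarith
  have hmaxi : ∀ x, Integrable (fun s => max (s - x) 0) G := fun x =>
    (hi.sub (integrable_const _)).sup (integrable_const 0)
  have hopt_mono : ∫ s, max (s - (μ + d)) 0 ∂G ≤ ∫ s, max (s - (p + d)) 0 ∂G :=
    integral_mono (hmaxi _) (hmaxi _) fun s => max_le_max (by linarith) le_rfl
  have hint : ∫ s, a.disclosurePayoff φ s (σ s) ∂G = (∫ s, max (s - (p + d)) 0 ∂G) + p := by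
    have h1 : ∀ᵐ s ∂G, a.disclosurePayoff φ s (σ s) = max (s - (p + d)) 0 + p := by
      filter_upwards [T.ae_mem_scores] with s hs
      rw [hpay s hs, hopt s hs, max_add]
      congr 1 <;> ring
    rw [integral_congr_ae h1, integral_add (hmaxi _) (integrable_const p)]
    simp
  have htest : a.testProb = 1 := by
    refine le_antisymm h.testProb_mem.2 ?_
    have h1 := h.test_optimal 1 (by norm_num)
    rw [Assessment.agentPayoff, Assessment.agentPayoff, hint] at h1
    by_contra hlt
    have hlt := not_le.1 hlt
    change 1 * _ + (1 - 1) * p ≤ _ * _ + _ * p at h1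
    nlinarith
  refine ⟨htest, p + d, ?_, ?_⟩
  · rw [htest] at hbayes
    -- Optimal disclosure gives `(p + d - s)⁺ = (1 - σ s) * (p + d - s)` at every possible score,
    -- for any mixing at indifference. Bayes' rule removes the part in `s - p`.
    have e : integratedCDF G (p + d) = ∫ s, ((1 - σ s) * d - (1 - σ s) * (s - p)) ∂G := by
      refine integral_congr_ae ?_
      filter_upwards [T.ae_mem_scores] with s hs
      have h1 := hopt s hs
      have h2 : max (p + d - s) 0 = max (s - d) p - (s - d) := by
        rw [← max_sub_sub_right, sub_self, max_comm]
        congr 1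
        ring
      change max (p + d - s) 0 = (1 - σ s) * d - (1 - σ s) * (s - p)
      rw [h2, ← h1]
      ring
    have e2 : Integrable (fun s => (1 - σ s) * (s - p)) G := by
      have : ∀ s, (1 - σ s) * (s - p) = (s - p) - σ s * (s - p) := fun s => by ring
      simp only [this]
      exact (hi.sub (integrable_const p)).sub hsp
    rw [e, integral_sub (f := fun s => (1 - σ s) * d) (((integrable_const 1).sub hσi).mul_const d) e2, integral_mul_const,
      integral_sub (integrable_const 1) hσi]
    simp only [integral_const, probReal_univ, smul_eq_mul, mul_one]
    linarith
  · have e : 1 - ∫ s, σ s ∂G = ∫ s, (1 - σ s) ∂G := by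
      rw [integral_sub (integrable_const 1) hσi]
      simp
    rw [e, ← mul_one (cdf G (p + d)), ← integral_Iic_indicator]
    refine integral_mono_ae ((integrable_const 1).sub hσi)
      ((integrable_const _).indicator measurableSet_Iic) ?_
    filter_upwards [T.ae_mem_scores] with s hs
    rcases le_or_gt s (p + d) with h1 | h1
    · rw [Set.indicator_of_mem (by exact h1)]
      exact sub_le_self _ (hσ1 s).1
    · rw [Set.indicator_of_notMem (by simpa using h1)]
      have h2 := hopt s hs
      rw [max_eq_left (by linarith)] at h2
      have h3 : (1 - σ s) * (s - d - p) = 0 := by linarith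
      rcases mul_eq_zero.1 h3 with h4 | h4
      · exact h4.le
      · linarith

/-- The exponential law has `d G = H` for `d = θh - μ` throughout its continuous part, so at that
fee every point there is a threshold. A slightly lower fee removes these equilibria and leaves
scores worth disclosing above `μ + d`, which makes testing strictly optimal. -/
theorem le_maxRevenueGuarantee_binary (hθ : θl < θh) (hF : F.support = {θl, θh}) :
    (((θh - priorMean F) *
      (1 - Real.exp ((θl - priorMean F) / (θh - priorMean F))) : ℝ) : EReal) ≤
      maxRevenueGuarantee F := by
  have hl : IsLeast F.support θl := by
    rw [hF]
    exact ⟨by simp, by rintro x (rfl | rfl); exacts [le_rfl, hθ.le]⟩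
  have hh : IsGreatest F.support θh := by
    rw [hF]
    exact ⟨by simp, by rintro x (rfl | rfl); exacts [hθ.le, le_rfl]⟩
  have hsub := support_subset_Icc hl hh
  have hlμ := lt_priorMean hθ hl hh
  have hμh := priorMean_lt hθ hl hh
  set μ := priorMean F with hμ
  have hpar := stepExpParams_of_lt hlμ hμh
  set g := Real.exp ((θl - μ) / (θh - μ)) with hg
  have := hpar.isProbabilityMeasure_law
  have hlaw := hpar.ae_mem_law
  rw [add_sub_cancel_right] at hlaw
  obtain ⟨T, hT⟩ := exists_unbiasedTest_binary hθ hF hlaw hpar.mean_law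
  have htop := hpar.isTopThreshold_law (by linarith) (by linarith)
  have hg0 : 0 < g := hpar.g_pos
  -- the guarantee of the structures with slightly lower disclosure fees
  have key : ∀ d, 0 < d → d < θh - μ →
      ((d * (1 - g) : ℝ) : EReal) ≤ maxRevenueGuarantee F := by
    intro d hd hdh
    refine le_trans ?_ (le_iSup₂_of_le T ⟨0, d⟩ le_rfl)
    refine le_iInf₂ fun a ha => EReal.coe_le_coe_iff.2 ?_
    have hcdf : cdf hpar.law (μ + d) < 1 := by
      rw [hpar.cdf_law, stepExpFun]
      split_ifs with h1 h2
      · norm_num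
      · rw [expSlope, hg, ← Real.exp_add, Real.exp_lt_one_iff, ← add_div]
        refine div_neg_of_neg_of_pos ?_ (by linarith)
        have : clampTo (θl + (θh - μ)) θh (μ + d) < θh :=
          (min_le_left _ _).trans_lt (max_lt (by linarith) (by linarith))
        linarith
      · linarith
    have hpos : (0 : ℝ) < ∫ s, max (s - (μ + d)) 0 ∂T.scoreLaw := by
      rw [hT, integral_pos_iff_support_of_nonneg_ae (f := fun s => max (s - (μ + d)) 0)
        (ae_of_all _ fun s => le_max_right _ _)
        (((integrable_of_ae_mem_Icc hlaw).sub (integrable_const _)).sup (integrable_const 0))]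
      have h1 : 0 < hpar.law (Set.Ioi (μ + d)) := by
        rw [← Set.compl_Iic, pos_iff_ne_zero, Ne, prob_compl_eq_zero_iff measurableSet_Iic,
          ← ofReal_cdf, ENNReal.ofReal_eq_one]
        exact hcdf.ne
      refine h1.trans_le (measure_mono fun s hs => ?_)
      exact (lt_max_of_lt_left (sub_pos.2 hs)).ne'
    obtain ⟨htest, τ, hH, hN⟩ := ha.exists_threshold hsub hd hpos
    rw [Assessment.revenue, htest]
    rw [hT] at hH hN ⊢
    simp only at hH ⊢
    set S := ∫ s, a.discloseProb s ∂hpar.law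
    -- Below `θl + (θh - μ)` the CDF is at most the atom `g`. A threshold further up would give `(θh
    -- - μ) * G(τ) ≤ H(τ) = d * (1 - S) ≤ d * G(τ)`, impossible for `d < θh - μ`.
    have hSg : 1 - S ≤ g := by
      rcases lt_or_ge τ (θl + (θh - μ)) with h1 | h1
      · refine hN.trans ?_
        rw [hpar.cdf_law, stepExpFun]
        split_ifs with h2 h3
        · exact hg0.le
        · rw [expSlope_of_le (by linarith) h1.le]
        · linarith
      · exfalso
        have h2 : (θh - μ) * cdf hpar.law τ ≤ integratedCDF hpar.law τ := by
          rcases h1.eq_or_lt with h1 | h1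
          · rw [← h1]; exact htop.eq.le
          · exact htop.le τ h1
        have h3 := (htop.pos (by linarith)).trans_le (monotone_cdf hpar.law h1)
        nlinarith
    nlinarith
  have hlim : Filter.Tendsto (fun d : ℝ => ((d * (1 - g) : ℝ) : EReal))
      (nhdsWithin (θh - μ) (Set.Iio (θh - μ))) (nhds (((θh - μ) * (1 - g) : ℝ) : EReal)) :=
    ((continuous_coe_real_ereal.comp (continuous_id.mul continuous_const)).tendsto
      (θh - μ)).mono_left nhdsWithin_le_nhds
  refine le_of_tendsto hlim ?_
  filter_upwards [self_mem_nhdsWithin, mem_nhdsWithin_of_mem_nhds (Ioi_mem_nhds (sub_pos.2 hμh))]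
    with d h1 h2 using key d h2 h1

end AllEquilibria

theorem proposition2 (F : Measure ℝ) [IsProbabilityMeasure F] (θl θh : ℝ)
    (hθ0 : 0 ≤ θl) (hθ : θl < θh)
    (hl : IsLeast F.support θl) (hh : IsGreatest F.support θh) :
    (∃ (G : Measure ℝ) (φ : Fees),
      IsStepExpStep (priorMean F) G φ ∧ IsRobustlyOptimal θl θh F G φ) ∧
    (∀ (G : Measure ℝ) (φ : Fees), IsRobustlyOptimal θl θh F G φ → 0 < φ.disclosure) ∧
    (∀ (G : Measure ℝ) (φ : Fees), IsRobustlyOptimal θl θh F G φ →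
      (0 < φ.testing ↔ 0 < G (Set.Ioc (priorMean F + φ.disclosure) θh))) ∧
    maxRevenueGuarantee F ≤
      (((θh - priorMean F) *
        (1 - Real.exp ((θl - priorMean F) / (θh - priorMean F))) : ℝ) : EReal) ∧
    (F.support = {θl, θh} →
      maxRevenueGuarantee F =
        (((θh - priorMean F) *
          (1 - Real.exp ((θl - priorMean F) / (θh - priorMean F))) : ℝ) : EReal)) := by
  refine ⟨exists_isStepExpStep_isRobustlyOptimal hθ hl hh,
    fun G φ h => h.disclosure_pos hθ hl hh, fun G φ h => h.testing_pos_iff,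
    iSup₂_le (revenueGuarantee_le hθ hl hh), fun hF => ?_⟩
  exact le_antisymm (iSup₂_le (revenueGuarantee_le hθ hl hh))
    (le_maxRevenueGuarantee_binary hθ hF)
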